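/- Setting. Let $K\ge 2$, $\sigma,B,c>0$. A bandit model $\nu=(\nu_a)_{a\in[K]}$ assigns to each arm $a$ a probability distribution $\nu_a$ on $\mathbb R$ with mean $\mu_a$; let $\mathcal M$ be the class of models with $\mu_a\in[0,B]$ and $\nu_a$ $\sigma$-sub-Gaussian, i.e. $\mathbb E_{X\sim\nu_a}\,e^{t(X-\mu_a)}\le e^{\sigma^2t^2/2}$ for all $t\in\mathbb R$ and all $a$. Let $0=\Delta_1(\nu)\le\Delta_2(\nu)\le\dots\le\Delta_K(\nu)$ be the gaps $\max_b\mu_b-\mu_a$ in increasing order, and $\mathcal H(\nu)=\sum_{k=2}^K\Delta_k(\nu)^{-2}\in(0,\infty]$ (with $0^{-2}=\infty$). For $H\in(0,\infty]$ and $\Delta_2\ge0$ let $\mathcal M_{H,\Delta_2}=\{\nu\in\mathcal M:\mathcal H(\nu)\le H,\ \Delta_2(\nu)=\Delta_2\}$. Algorithm (DBCARE) with budget function $N^*$ and confidence $\delta$. Start with $S=[K]$, $n=0$. While $n\le N^*(|S|)$ and $|S|>1$: increase $n$ by $1$; pull every arm of $S$ once, observing independent samples of the corresponding $\nu_k$;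 let $\hat\mu_k(n)$ be the average of the $n$ observations of arm $k\in S$ and $e_n=\sqrt{4\sigma^2n^{-1}\log(Kn/\delta)}$ (read as $0$ if the logarithm is negative); remove from $S$ all $k$ with $\max_{\ell\in S}\hat\mu_\ell(n)-\hat\mu_k(n)>e_n$. At the end, recommend $\hat I\in\arg\max_{a\in S}\hat\mu_a(n)$, ties being broken uniformly at random. Let $\tau$ be the total number of pulls and $R_2(\nu)=\mathbb E\big[\max_b\mu_b-\mu_{\hat I}+c\tau\big]$ the risk. Throughout, the algorithm is run with $$N^*(k)=\frac{3}{2e}\,\sigma^{2/3}\big((k-1)c\big)^{-2/3},\qquad \delta=\frac{c}{B+eK^{1/3}\log(K)\,N^*(2)} .$$ Put $$h_2(H)=\begin{cases}\frac{c\sigma^2H}{4}\log\!\Big(\frac{e\Delta_2}{\sigma^2cH}\Big)&\text{if }H\Delta_2^{-1}\le(\sigma^2c)^{-1},\\[2pt] \Delta_2/4&\text{if }H\Delta_2^{-1}>(\sigma^2c)^{-1},\end{cases}\qquad h_2^*=\frac38\Big(\frac{(K-1)\sigma^2c}{e}\Big)^{1/3}\!,\qquad L=\frac{K\log(K)\,B\,\sigma^{4/3}}{c^{5/3}},$$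 where $H\Delta_2^{-1}=\infty$ if $\Delta_2=0$. Theorem. (1) If $H\Delta_2^{-1}\le(\sigma^2c)^{-1}$, $B\ge1$ and $L\ge1$, then $$\sup_{\nu\in\mathcal M_{H,\Delta_2}}R_2(\nu)\le 550\,\log(K)\,\log(L)\,h_2(H)+(K+1)c .$$ (2) If $H\Delta_2^{-1}>(\sigma^2c)^{-1}$, then $$\sup_{\nu\in\mathcal M_{H,\Delta_2}}R_2(\nu)\le h_2(H)+4\log(K)\,(K\sigma^2c)^{1/3}+(K+1)c .$$ (3) $$\sup_{\nu\in\mathcal M}R_2(\nu)\le 20\log(K)\,h_2^*+(K+1)c .$$ -/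

import Mathlib

open scoped ENNReal

namespace CostBandit

noncomputable section

/-! ### Bandit models -/

/-- A bandit model with `K` arms: each arm carries a reward distribution on `ℝ`.
No ordering of the arms is imposed. -/
abbrev Model (K : ℕ) := Fin K → MeasureTheory.ProbabilityMeasure ℝ

/-- `μ_a`, the expected reward of arm `a`. -/
def mean {K : ℕ} (ν : Model K) (a : Fin K) : ℝ :=
  ∫ x, x ∂(ν a : MeasureTheory.Measure ℝ)

/-- `P` is `σ`-sub-Gaussian: `E exp (t (X - E X)) ≤ exp (σ² t² / 2)` for every real `t`
(and all these exponential moments are finite). -/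
def IsSubGaussian (σ : ℝ) (P : MeasureTheory.Measure ℝ) : Prop :=
  ProbabilityTheory.HasSubgaussianMGF (fun x => x - ∫ y, y ∂P) (Real.toNNReal (σ ^ 2)) P

/-- The class of models with `σ`-sub-Gaussian arms whose means lie in `[0, B]`. -/
def modelClass (K : ℕ) (σ B : ℝ) : Set (Model K) :=
  {ν | ∀ a, IsSubGaussian σ (ν a : MeasureTheory.Measure ℝ) ∧ mean ν a ∈ Set.Icc 0 B}

/-- The sub-optimality gap of arm `a`: the largest mean minus `μ_a`. -/
def gap {K : ℕ} (ν : Model K) (a : Fin K) : ℝ :=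
  (⨆ b, mean ν b) - mean ν a

/-- The gaps in increasing order: `sortedGap ν i` is `Δ_{i+1}`, so that
`0 = Δ₁ ≤ Δ₂ ≤ … ≤ Δ_K`. -/
def sortedGap {K : ℕ} (ν : Model K) (i : Fin K) : ℝ :=
  gap ν (Tuple.sort (gap ν) i)

/-- `Δ₂`, the smallest gap: the best mean minus the second best one. -/
def minGap {K : ℕ} (hK : 2 ≤ K) (ν : Model K) : ℝ :=
  sortedGap ν ⟨1, hK⟩

/-- The complexity `∑_{k=2}^K Δ_k⁻²`; it is `∞` if the best arm is not unique. -/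
def complexity {K : ℕ} (ν : Model K) : ℝ≥0∞ :=
  ∑ i : Fin K with 0 < i.val, (ENNReal.ofReal (sortedGap ν i) ^ 2)⁻¹

/-- The models of the class with complexity at most `H` and smallest gap `Δ₂`. -/
def modelClassH {K : ℕ} (hK : 2 ≤ K) (σ B : ℝ) (H : ℝ≥0∞) (Δ₂ : ℝ) : Set (Model K) :=
  {ν | ν ∈ modelClass K σ B ∧ complexity ν ≤ H ∧ minGap hK ν = Δ₂}

/-! ### The elimination algorithm

The rewards are read from a table `ω`: the entry `ω (k, s)` is the reward of the pull number `s`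
of arm `k` (counted from `0`). All entries are independent and `ω (k, s)` has law `ν k`. -/

/-- The law of the reward table. -/
def tableLaw {K : ℕ} (ν : Model K) : MeasureTheory.Measure (Fin K × ℕ → ℝ) :=
  MeasureTheory.Measure.infinitePi
    (fun p : Fin K × ℕ => (ν p.1 : MeasureTheory.Measure ℝ))

/-- The empirical mean of the first `n` rewards of arm `k`. -/
def empMean {K : ℕ} (ω : Fin K × ℕ → ℝ) (k : Fin K) (n : ℕ) : ℝ :=
  (∑ s ∈ Finset.range n, ω (k, s)) / n

/-- The confidence width `e_n = √(4 σ² n⁻¹ log (K n / δ))`. -/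
def width (K : ℕ) (σ δ : ℝ) (n : ℕ) : ℝ :=
  Real.sqrt (4 * σ ^ 2 * (n : ℝ)⁻¹ * Real.log (K * n * δ⁻¹))

/-- The surviving set `S` after `n` epochs. In epoch `n + 1` every arm of `S` is pulled once, so
that it has been pulled `n + 1` times, and then the arms whose empirical mean is more than
`e_{n+1}` below the largest one in `S` are removed. -/
def survivors {K : ℕ} (σ δ : ℝ) (ω : Fin K × ℕ → ℝ) : ℕ → Finset (Fin K)
  | 0 => Finset.univ
  | n + 1 => {k ∈ survivors σ δ ω n | ∀ l ∈ survivors σ δ ω n,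
      empMean ω l (n + 1) - empMean ω k (n + 1) ≤ width K σ δ (n + 1)}

/-- The loop condition after `n` epochs: `n ≤ N (|S|)` and `|S| > 1`. -/
def Continues {K : ℕ} (N : ℕ → ℝ) (σ δ : ℝ) (ω : Fin K × ℕ → ℝ) (n : ℕ) : Prop :=
  (n : ℝ) ≤ N (survivors σ δ ω n).card ∧ 1 < (survivors σ δ ω n).card

/-- The loop ends, whatever the budget function `N` is. -/
theorem exists_not_continues {K : ℕ} (N : ℕ → ℝ) (σ δ : ℝ) (ω : Fin K × ℕ → ℝ) :
    ∃ n, ¬ Continues N σ δ ω n := by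
  obtain ⟨n, hn⟩ := exists_nat_gt (∑ k ∈ Finset.range (K + 1), |N k|)
  refine ⟨n, fun h => ?_⟩
  have hc : (survivors σ δ ω n).card ∈ Finset.range (K + 1) := by
    have := Finset.card_le_univ (survivors σ δ ω n)
    simp only [Fintype.card_fin] at this
    simp only [Finset.mem_range]
    omega
  have h1 := Finset.single_le_sum (f := fun k => |N k|) (fun i _ => abs_nonneg _) hc
  have h2 := le_abs_self (N (survivors σ δ ω n).card)
  have h3 := h.1
  linarith

/-- The number of completed epochs: the first `n` at which the loop condition fails. -/
def epochs {K : ℕ} (N : ℕ → ℝ) (σ δ : ℝ) (ω : Fin K × ℕ → ℝ) : ℕ :=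
  sInf {n | ¬ Continues N σ δ ω n}

/-- The stopping time `τ`, the total number of pulls: epoch `n + 1` pulls once each arm that
survived the first `n` epochs. -/
def totalPulls {K : ℕ} (N : ℕ → ℝ) (σ δ : ℝ) (ω : Fin K × ℕ → ℝ) : ℕ :=
  ∑ n ∈ Finset.range (epochs N σ δ ω), (survivors σ δ ω n).card

/-- The surviving arms with the largest empirical mean at the end. -/
def leaders {K : ℕ} (N : ℕ → ℝ) (σ δ : ℝ) (ω : Fin K × ℕ → ℝ) : Finset (Fin K) :=
  {k ∈ survivors σ δ ω (epochs N σ δ ω) | ∀ l ∈ survivors σ δ ω (epochs N σ δ ω),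
    empMean ω l (epochs N σ δ ω) ≤ empMean ω k (epochs N σ δ ω)}

/-- The conditional probability, given the rewards, that arm `a` is recommended: ties among the
leaders are broken uniformly at random. -/
def recommendProb {K : ℕ} (N : ℕ → ℝ) (σ δ : ℝ) (ω : Fin K × ℕ → ℝ) (a : Fin K) : ℝ≥0∞ :=
  if a ∈ leaders N σ δ ω then ((leaders N σ δ ω).card : ℝ≥0∞)⁻¹ else 0

theorem survivors_nonempty {K : ℕ} (hK : 0 < K) (σ δ : ℝ) (ω : Fin K × ℕ → ℝ) (n : ℕ) :
    (survivors σ δ ω n).Nonempty := by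
  induction n with
  | zero => exact ⟨⟨0, hK⟩, Finset.mem_univ _⟩
  | succ n ih =>
    obtain ⟨k, hk, hmax⟩ := Finset.exists_max_image _ (fun l => empMean ω l (n + 1)) ih
    refine ⟨k, ?_⟩
    rw [survivors, Finset.mem_filter]
    refine ⟨hk, fun l hl => ?_⟩
    have h1 := hmax l hl
    have h2 : 0 ≤ width K σ δ (n + 1) := Real.sqrt_nonneg _
    linarith

/-- The recommendation probabilities add up to one. -/
theorem sum_recommendProb {K : ℕ} (hK : 0 < K) (N : ℕ → ℝ) (σ δ : ℝ) (ω : Fin K × ℕ → ℝ) :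
    ∑ a, recommendProb N σ δ ω a = 1 := by
  have hne : (leaders N σ δ ω).Nonempty := by
    obtain ⟨k, hk, hmax⟩ := Finset.exists_max_image _
      (fun l => empMean ω l (epochs N σ δ ω)) (survivors_nonempty hK σ δ ω (epochs N σ δ ω))
    exact ⟨k, by rw [leaders, Finset.mem_filter]; exact ⟨hk, hmax⟩⟩
  simp only [recommendProb, Finset.sum_ite_mem, Finset.univ_inter, Finset.sum_const, nsmul_eq_mul]
  exact ENNReal.mul_inv_cancel (by simpa using hne.ne_empty) (ENNReal.natCast_ne_top _)

/-- The risk `E[(μ₁ - μ_Î) + c τ]` (simple regret plus sampling cost) of the elimination algorithm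
with budget function `N` and confidence `δ` on the model `ν`. The inner sum is the conditional
expectation of the simple regret given the rewards. -/
def risk {K : ℕ} (N : ℕ → ℝ) (σ δ c : ℝ) (ν : Model K) : ℝ≥0∞ :=
  ∫⁻ ω, ((∑ a, recommendProb N σ δ ω a * ENNReal.ofReal (gap ν a))
      + ENNReal.ofReal c * (totalPulls N σ δ ω : ℝ≥0∞)) ∂(tableLaw ν)

/-! ### The parameters and the comparison quantities -/

/-- The budget `N*(k) = (3/(2e)) σ^{2/3} ((k-1) c)^{-2/3}`. Only `k ≥ 2` matters. -/
def Nstar (σ c : ℝ) (k : ℕ) : ℝ :=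
  3 / (2 * Real.exp 1) * σ ^ (2 / 3 : ℝ) * (((k : ℝ) - 1) * c) ^ (-(2 / 3) : ℝ)

/-- The confidence `δ = c (B + e K^{1/3} log K · N*(2))⁻¹`. -/
def conf (K : ℕ) (σ B c : ℝ) : ℝ :=
  c * (B + Real.exp 1 * (K : ℝ) ^ (1 / 3 : ℝ) * Real.log K * Nstar σ c 2)⁻¹

/-- The risk of the elimination algorithm with these parameters. -/
def dbcareRisk {K : ℕ} (σ B c : ℝ) (ν : Model K) : ℝ≥0∞ :=
  risk (Nstar σ c) σ (conf K σ B c) c ν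

/-- The quantity `h₂(H)` for the smallest gap `Δ₂`. -/
def hardness (σ c : ℝ) (H : ℝ≥0∞) (Δ₂ : ℝ) : ℝ :=
  open Classical in
  if H / ENNReal.ofReal Δ₂ ≤ ENNReal.ofReal (σ ^ 2 * c)⁻¹ then
    c * σ ^ 2 * H.toReal / 4 * Real.log (Real.exp 1 * Δ₂ / (σ ^ 2 * c * H.toReal))
  else Δ₂ / 4

/-- The minimax quantity `h₂* = (3/8) ((K-1) σ² c / e)^{1/3}`. -/
def hardnessStar (K : ℕ) (σ c : ℝ) : ℝ :=
  3 / 8 * (((K : ℝ) - 1) * σ ^ 2 * c / Real.exp 1) ^ (1 / 3 : ℝ)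

end

end CostBandit

namespace CostBandit

open MeasureTheory ProbabilityTheory

/-! ### Concentration -/

/-! Fix a best arm `b`. Everything is controlled by three families of events, each comparing one arm
`a` with `b` at a deterministic time, so that sub-Gaussian tails apply. (i) `a` beats `b` by the
full width at epoch n. Outside these events `b` is never removed; on them the extra loss is at most
a constant times B, which is paid for by Bδ ≤ c. (ii) If the loop stops with k ≥ 2 arms,
monotonicity of the budget forces exactly n_k = ⌊N*(k)⌋ + 1 epochs. The random stopping time thus
becomes a union over k: a recommended arm is at least as good empirically as `b` at time n_k. Gaps
up to a threshold θσ/√n_k are charged the threshold, larger ones a Gaussian tail. (iii) `a` passes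
the elimination test against `b` at epoch n. The number of such passes bounds the sampling cost.
`risk_le_of_forall` integrates a pointwise bound by these indicators.

Gap-independent bound (`dbcareRisk_le`, giving (2) and (3)): the cost is surely at most c times a
sum of budgets, of order (Kσ²c)^{1/3}, and σ/√n_k is at most of order ((k-1)σ²c)^{1/3}. A θ of order
√(log K) beats the union over arms and values of k.

Complexity bound (1): the same budget satisfies σ/√n_k ≤ 2.44 c n_k (k-1), so the threshold is
itself paid for by the passes already made, whose expected number is at most of order σ²H times the
logarithm in the widths (`dbcareRisk_le_of_complexity`). This logarithm is at most 3 log L if N*(2)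
≥ 1. If N*(2) < 1 there is a single epoch; log L may then be close to 0, and the spare summand c has
to absorb the regret. Finally σ²cH ≤ 4 h₂(H), because the logarithm in h₂ is at least 1. -/

instance instIsProbabilityMeasureTableLaw {K : ℕ} (ν : Model K) :
    IsProbabilityMeasure (tableLaw ν) := by
  unfold tableLaw; infer_instance

theorem measurable_empMean {K : ℕ} (k : Fin K) (n : ℕ) :
    Measurable (fun ω : Fin K × ℕ → ℝ => empMean ω k n) := by
  unfold empMean
  fun_prop

/-- Deviation bound for the difference of two empirical means. -/
theorem tableLaw_le_empMean_sub {K : ℕ} (ν : Model K) {σ : ℝ} (hσ : 0 < σ)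
    (hsub : ∀ a, IsSubGaussian σ (ν a : Measure ℝ)) {a b : Fin K} (hab : a ≠ b) {n : ℕ}
    (hn : 0 < n) {y : ℝ} (hy : 0 ≤ y + (mean ν b - mean ν a)) :
    tableLaw ν {ω | y ≤ empMean ω a n - empMean ω b n} ≤
      ENNReal.ofReal (Real.exp (-(n * (y + (mean ν b - mean ν a)) ^ 2 / (4 * σ ^ 2)))) := by
  classical
  -- Centred rewards, signed + for `a` and - for all other arms; only the rows `a` and `b` enter the
  -- sum.
  set X : Fin K × ℕ → ℝ → ℝ := fun p x =>
    if p.1 = a then x - mean ν p.1 else -(x - mean ν p.1) with hX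
  have hXm : ∀ p, Measurable (X p) := by
    intro p
    simp only [hX]
    split_ifs <;> fun_prop
  have hind : iIndepFun (fun p (ω : Fin K × ℕ → ℝ) => X p (ω p)) (tableLaw ν) :=
    iIndepFun_infinitePi hXm
  have hsg : ∀ p, HasSubgaussianMGF (fun ω : Fin K × ℕ → ℝ => X p (ω p))
      (Real.toNNReal (σ ^ 2)) (tableLaw ν) := by
    intro p
    have hmap : (tableLaw ν).map (fun ω => ω p) = (ν p.1 : Measure ℝ) :=
      Measure.infinitePi_map_eval _ p
    have h0 : HasSubgaussianMGF (X p) (Real.toNNReal (σ ^ 2)) (ν p.1 : Measure ℝ) := by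
      by_cases hp : p.1 = a
      · simp only [hX, hp, if_true]
        exact hsub a
      · simp only [hX, hp, if_false]
        exact (hsub p.1).neg
    exact HasSubgaussianMGF.of_map (Y := fun ω : Fin K × ℕ → ℝ => ω p)
      (measurable_pi_apply p).aemeasurable (by rw [hmap]; exact h0)
  set s : Finset (Fin K × ℕ) := ({a, b} : Finset (Fin K)) ×ˢ Finset.range n with hs
  have hn' : (0 : ℝ) < n := by exact_mod_cast hn
  have key := HasSubgaussianMGF.measure_sum_ge_le_of_iIndepFun hind (s := s)
    (c := fun _ => Real.toNNReal (σ ^ 2)) (fun p _ => hsg p)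
    (ε := n * (y + (mean ν b - mean ν a))) (by positivity)
  have hset : {ω : Fin K × ℕ → ℝ | y ≤ empMean ω a n - empMean ω b n} =
      {ω | n * (y + (mean ν b - mean ν a)) ≤ ∑ p ∈ s, X p (ω p)} := by
    ext ω
    have hsum : ∑ p ∈ s, X p (ω p) = n * (empMean ω a n - empMean ω b n)
        + n * (mean ν b - mean ν a) := by
      rw [hs, Finset.sum_product, Finset.sum_pair hab]
      simp only [hX, if_true, hab.symm, if_false, Finset.sum_neg_distrib, Finset.sum_sub_distrib,
        Finset.sum_const, Finset.card_range, nsmul_eq_mul, empMean]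
      field_simp
      ring
    simp only [Set.mem_ofPred_eq, hsum]
    rw [mul_add]
    constructor
    · intro h
      have := mul_le_mul_of_nonneg_left h hn'.le
      linarith
    · intro h
      exact le_of_mul_le_mul_left (by linarith) hn'
  rw [hset, ← ofReal_measureReal]
  refine ENNReal.ofReal_le_ofReal (key.trans_eq ?_)
  congr 1
  -- 2n summands of variance proxy σ² produce the 4σ² in the exponent.
  have hcard : s.card = 2 * n := by
    rw [hs, Finset.card_product, Finset.card_pair hab, Finset.card_range]
  rw [Finset.sum_const, hcard]
  have hc : ((Real.toNNReal (σ ^ 2) : NNReal) : ℝ) = σ ^ 2 := Real.coe_toNNReal _ (by positivity)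
  simp only [nsmul_eq_mul]
  push_cast
  rw [hc]
  field_simp
  ring

/-- Only the events `E i` have to be measurable, not `f`: the majorant is integrated instead. So
measurability of the stopping time and of the recommendation never has to be shown. -/
theorem lintegral_le_of_le_sum_indicator {Ω ι : Type*} [MeasurableSpace Ω] (P : Measure Ω)
    [IsProbabilityMeasure P] (f : Ω → ℝ≥0∞) (I : Finset ι) (C₀ : ℝ) (C p : ι → ℝ)
    (E : ι → Set Ω) (hE : ∀ i ∈ I, MeasurableSet (E i)) (hC₀ : 0 ≤ C₀)
    (hC : ∀ i ∈ I, 0 ≤ C i) (hp : ∀ i ∈ I, 0 ≤ p i)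
    (hP : ∀ i ∈ I, P (E i) ≤ ENNReal.ofReal (p i))
    (hf : ∀ ω, f ω ≤ ENNReal.ofReal (C₀ + ∑ i ∈ I, C i * (E i).indicator 1 ω)) :
    ∫⁻ ω, f ω ∂P ≤ ENNReal.ofReal (C₀ + ∑ i ∈ I, C i * p i) := by
  have h1 : ∀ ω, f ω ≤ ENNReal.ofReal C₀ +
      ∑ i ∈ I, (E i).indicator (fun _ => ENNReal.ofReal (C i)) ω := by
    intro ω
    refine (hf ω).trans (ENNReal.ofReal_add_le.trans ?_)
    gcongr
    rw [ENNReal.ofReal_sum_of_nonneg]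
    · refine Finset.sum_le_sum fun i hi => ?_
      by_cases h : ω ∈ E i <;> simp [h]
    · intro i hi
      exact mul_nonneg (hC i hi) (Set.indicator_nonneg (fun _ _ => zero_le_one) _)
  refine (lintegral_mono h1).trans ?_
  rw [lintegral_add_left measurable_const, lintegral_finsetSum']
  · rw [lintegral_const, measure_univ, mul_one,
      ENNReal.ofReal_add hC₀ (Finset.sum_nonneg fun i hi => mul_nonneg (hC i hi) (hp i hi)),
      ENNReal.ofReal_sum_of_nonneg fun i hi => mul_nonneg (hC i hi) (hp i hi)]
    gcongr with i hi
    rw [lintegral_indicator_const (hE i hi), ENNReal.ofReal_mul (hC i hi)]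
    gcongr
    exact hP i hi
  · intro i hi
    exact (measurable_const.indicator (hE i hi)).aemeasurable

/-! ### The deterministic part of the elimination algorithm -/

section

variable {K : ℕ} {N : ℕ → ℝ} {σ δ : ℝ} {ω : Fin K × ℕ → ℝ}

theorem survivors_succ_subset (σ δ : ℝ) (ω : Fin K × ℕ → ℝ) (n : ℕ) :
    survivors σ δ ω (n + 1) ⊆ survivors σ δ ω n := by
  rw [survivors]
  exact Finset.filter_subset _ _

theorem survivors_antitone (σ δ : ℝ) (ω : Fin K × ℕ → ℝ) : Antitone (survivors σ δ ω) :=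
  antitone_nat_of_succ_le (survivors_succ_subset σ δ ω)

theorem continues_of_lt_epochs {n : ℕ} (h : n < epochs N σ δ ω) : Continues N σ δ ω n := by
  by_contra hc
  exact absurd (Nat.sInf_le (s := {n | ¬ Continues N σ δ ω n}) hc) (not_le.2 h)

theorem not_continues_epochs : ¬ Continues N σ δ ω (epochs N σ δ ω) :=
  Nat.sInf_mem (s := {n | ¬ Continues N σ δ ω n}) (exists_not_continues N σ δ ω)

theorem card_survivors_le (n : ℕ) : (survivors σ δ ω n).card ≤ K := by
  simpa using Finset.card_le_univ (survivors σ δ ω n)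

theorem epochs_pos (hK : 2 ≤ K) (hN0 : ∀ k, 2 ≤ k → 0 ≤ N k) : 0 < epochs N σ δ ω := by
  rw [Nat.pos_iff_ne_zero]
  intro h
  apply not_continues_epochs (N := N) (σ := σ) (δ := δ) (ω := ω)
  rw [h]
  have hc : (survivors σ δ ω 0).card = K := by simp [survivors]
  exact ⟨by rw [hc]; simpa using hN0 K hK, by rw [hc]; omega⟩

theorem epochs_le (hN : ∀ k l, 2 ≤ k → k ≤ l → N l ≤ N k) :
    epochs N σ δ ω ≤ ⌊N 2⌋₊ + 1 := by
  by_contra! h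
  obtain ⟨h1, h2⟩ := continues_of_lt_epochs h
  have h3 := (h1.trans (hN 2 _ le_rfl h2))
  have h4 := Nat.lt_floor_add_one (N 2)
  push_cast at h3
  linarith

/-- Failure of the loop condition at the end gives N k < T. One epoch earlier the set was at least
as large, hence its budget at most N k, which gives T - 1 ≤ N k. So T is a function of the final
number of arms. -/
theorem epochs_eq (hN : ∀ k l, 2 ≤ k → k ≤ l → N l ≤ N k) (hN0 : ∀ k, 2 ≤ k → 0 ≤ N k)
    (hcard : 2 ≤ (survivors σ δ ω (epochs N σ δ ω)).card) (hpos : 0 < epochs N σ δ ω) :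
    epochs N σ δ ω = ⌊N (survivors σ δ ω (epochs N σ δ ω)).card⌋₊ + 1 := by
  set T := epochs N σ δ ω with hT
  set k := (survivors σ δ ω T).card with hk
  have h1 : N k < T := by
    by_contra! h
    exact not_continues_epochs (N := N) (σ := σ) (δ := δ) (ω := ω) ⟨h, hcard⟩
  obtain ⟨h2, h3⟩ := continues_of_lt_epochs (N := N) (σ := σ) (δ := δ) (ω := ω)
    (n := T - 1) (by omega)
  have h4 : k ≤ (survivors σ δ ω (T - 1)).card :=
    Finset.card_le_card (survivors_antitone σ δ ω (Nat.sub_le T 1))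
  have h5 := h2.trans (hN k _ hcard h4)
  have h6 : ⌊N k⌋₊ < T := (Nat.floor_lt (hN0 k hcard)).2 h1
  have h7 : T - 1 ≤ ⌊N k⌋₊ := Nat.le_floor h5
  omega

/-- The compulsory first epoch is split off; it accounts for the K c in every bound. -/
theorem totalPulls_eq (hpos : 0 < epochs N σ δ ω) :
    totalPulls N σ δ ω = K + ∑ n ∈ Finset.Icc 1 (epochs N σ δ ω - 1),
      (survivors σ δ ω n).card := by
  unfold totalPulls
  obtain ⟨t, ht⟩ : ∃ t, epochs N σ δ ω = t + 1 := ⟨_, (Nat.succ_pred_eq_of_pos hpos).symm⟩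
  rw [ht, Finset.sum_range_succ', add_comm, Nat.add_sub_cancel]
  congr 1
  · simp [survivors]
  · rw [Finset.range_eq_Ico, Finset.sum_Ico_add' (fun n => (survivors σ δ ω n).card) 0 t 1]
    rfl

/-- Layer cake: |S| is 1 plus the number of k in [2, |S|], and the loop condition gives n ≤ N k for
each of them. After exchanging the sums, each k counts at most N k epochs; the summand 1 is counted
by the extra N 2. -/
theorem totalPulls_le (hN : ∀ k l, 2 ≤ k → k ≤ l → N l ≤ N k) (hN0 : ∀ k, 2 ≤ k → 0 ≤ N k)
    (hpos : 0 < epochs N σ δ ω) :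
    (totalPulls N σ δ ω : ℝ) ≤ K + (N 2 + ∑ k ∈ Finset.Icc 2 K, N k) := by
  rw [totalPulls_eq hpos]
  push_cast
  gcongr
  set T := epochs N σ δ ω with hT
  have hcount : ∀ k, 2 ≤ k →
      ∑ n ∈ Finset.Icc 1 (T - 1), (if (n : ℝ) ≤ N k then (1 : ℝ) else 0) ≤ N k := by
    intro k hk
    rw [Finset.sum_boole]
    refine le_trans ?_ (Nat.floor_le (hN0 k hk))
    have : ({n ∈ Finset.Icc 1 (T - 1) | (n : ℝ) ≤ N k} : Finset ℕ) ⊆ Finset.Icc 1 ⌊N k⌋₊ := by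
      intro n hn
      rw [Finset.mem_filter, Finset.mem_Icc] at hn
      exact Finset.mem_Icc.2 ⟨hn.1.1, Nat.le_floor hn.2⟩
    have := Finset.card_le_card this
    rw [Nat.card_Icc] at this
    exact_mod_cast this
  have hterm : ∀ n ∈ Finset.Icc 1 (T - 1), ((survivors σ δ ω n).card : ℝ) ≤
      (if (n : ℝ) ≤ N 2 then (1 : ℝ) else 0) +
        ∑ k ∈ Finset.Icc 2 K, (if (n : ℝ) ≤ N k then (1 : ℝ) else 0) := by
    intro n hn
    rw [Finset.mem_Icc] at hn
    obtain ⟨h1, h2⟩ := continues_of_lt_epochs (N := N) (σ := σ) (δ := δ) (ω := ω)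
      (n := n) (by omega)
    set s := (survivors σ δ ω n).card with hs
    have hsK : s ≤ K := card_survivors_le n
    rw [if_pos (h1.trans (hN 2 s le_rfl h2))]
    have h3 : ∑ k ∈ Finset.Icc 2 s, (1 : ℝ) ≤
        ∑ k ∈ Finset.Icc 2 K, (if (n : ℝ) ≤ N k then (1 : ℝ) else 0) := by
      refine (Finset.sum_le_sum fun k hk => ?_).trans (Finset.sum_le_sum_of_subset_of_nonneg
        (Finset.Icc_subset_Icc_right hsK) fun k _ _ => ?_)
      · rw [Finset.mem_Icc] at hk
        rw [if_pos (h1.trans (hN k s hk.1 hk.2))]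
      · split_ifs <;> norm_num
    have h4 : ∑ k ∈ Finset.Icc 2 s, (1 : ℝ) = (s : ℝ) - 1 := by
      rw [Finset.sum_const, Nat.card_Icc, nsmul_eq_mul, mul_one]
      rw [show s + 1 - 2 = s - 1 by omega, Nat.cast_sub (by omega)]
      simp
    linarith
  refine (Finset.sum_le_sum hterm).trans ?_
  rw [Finset.sum_add_distrib, Finset.sum_comm]
  exact add_le_add (hcount 2 le_rfl)
    (Finset.sum_le_sum fun k hk => hcount k (Finset.mem_Icc.1 hk).1)

/-! ### Survival of the best arm and the regret of the leaders -/

theorem mem_survivors_of_forall_le {b : Fin K} {M : ℕ}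
    (hgood : ∀ n, 1 ≤ n → n ≤ M → ∀ a, a ≠ b →
      empMean ω a n - empMean ω b n ≤ width K σ δ n) :
    ∀ n, n ≤ M → b ∈ survivors σ δ ω n := by
  intro n
  induction n with
  | zero => intro _; simp [survivors]
  | succ n ih =>
    intro hn
    rw [survivors, Finset.mem_filter]
    refine ⟨ih (by omega), fun l _ => ?_⟩
    by_cases hl : l = b
    · subst hl
      rw [sub_self]
      exact Real.sqrt_nonneg _
    · exact hgood (n + 1) (by omega) hn l hl

theorem sum_recommendProb_mul_le (hK : 0 < K) (ν : Model K) {y : ℝ}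
    (h : ∀ a ∈ leaders N σ δ ω, gap ν a ≤ y) :
    ∑ a, recommendProb N σ δ ω a * ENNReal.ofReal (gap ν a) ≤ ENNReal.ofReal y := by
  calc ∑ a, recommendProb N σ δ ω a * ENNReal.ofReal (gap ν a)
      ≤ ∑ a, recommendProb N σ δ ω a * ENNReal.ofReal y := by
        refine Finset.sum_le_sum fun a _ => ?_
        by_cases ha : a ∈ leaders N σ δ ω
        · gcongr
          exact h a ha
        · simp [recommendProb, ha]
    _ = ENNReal.ofReal y := by rw [← Finset.sum_mul, sum_recommendProb hK, one_mul]

/-- The reward tables for which after `n` pulls the empirical mean of `a` exceeds that of `b` by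
at least `y`. -/
def exceed (a b : Fin K) (n : ℕ) (y : ℝ) : Set (Fin K × ℕ → ℝ) :=
  {ω | y ≤ empMean ω a n - empMean ω b n}

theorem measurableSet_exceed (a b : Fin K) (n : ℕ) (y : ℝ) : MeasurableSet (exceed a b n y) :=
  measurableSet_le measurable_const ((measurable_empMean a n).sub (measurable_empMean b n))

/-- A bound for the gap of the recommended arm as long as the arm `b` is never removed. -/
noncomputable def tailSum (N : ℕ → ℝ) (ν : Model K) (b : Fin K) (x : ℕ → ℝ)
    (ω : Fin K × ℕ → ℝ) : ℝ :=
  ∑ p ∈ (Finset.univ.erase b) ×ˢ Finset.Icc 2 K, max (gap ν p.1 - x p.2) 0 *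
    (exceed p.1 b (⌊N p.2⌋₊ + 1) 0).indicator 1 ω

theorem tailSum_nonneg (N : ℕ → ℝ) (ν : Model K) (b : Fin K) (x : ℕ → ℝ)
    (ω : Fin K × ℕ → ℝ) : 0 ≤ tailSum N ν b x ω :=
  Finset.sum_nonneg fun _ _ =>
    mul_nonneg (le_max_right _ _) (Set.indicator_nonneg (fun _ _ => zero_le_one) _)

/-- With a single survivor, that survivor is `b` and the regret is 0. With k ≥ 2 survivors,
`epochs_eq` fixes the time, so any leader other than `b` switches on its own indicator in `tailSum`,
and this pays the part of its gap above x k. The value z is kept explicit because the two regimes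
charge it differently. -/
theorem sum_recommendProb_mul_le_tailSum (hN : ∀ k l, 2 ≤ k → k ≤ l → N l ≤ N k)
    (hN0 : ∀ k, 2 ≤ k → 0 ≤ N k) (hK : 2 ≤ K) (ν : Model K) {b : Fin K} (hb : gap ν b = 0)
    {x : ℕ → ℝ} (hx : ∀ k, 0 ≤ x k) (hmem : b ∈ survivors σ δ ω (epochs N σ δ ω)) :
    ∃ z : ℝ, 0 ≤ z ∧ (z = 0 ∨ (2 ≤ (survivors σ δ ω (epochs N σ δ ω)).card ∧
        z = x (survivors σ δ ω (epochs N σ δ ω)).card)) ∧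
      ∑ a, recommendProb N σ δ ω a * ENNReal.ofReal (gap ν a) ≤
        ENNReal.ofReal (z + tailSum N ν b x ω) := by
  have hpos : 0 < epochs N σ δ ω := epochs_pos hK hN0
  have htail := tailSum_nonneg N ν b x ω
  set k := (survivors σ δ ω (epochs N σ δ ω)).card with hk
  by_cases h2 : 2 ≤ k
  · refine ⟨x k, hx k, Or.inr ⟨h2, rfl⟩, sum_recommendProb_mul_le (by omega) ν fun a ha => ?_⟩
    by_cases hab : a = b
    · rw [hab, hb]
      have := hx k
      linarith
    rw [leaders, Finset.mem_filter] at ha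
    have hT := epochs_eq hN hN0 h2 hpos
    have h3 : ω ∈ exceed a b (⌊N k⌋₊ + 1) 0 := by
      rw [← hT]
      change (0 : ℝ) ≤ _
      have := ha.2 b hmem
      linarith
    have h4 := Finset.single_le_sum
      (f := fun p : Fin K × ℕ => max (gap ν p.1 - x p.2) 0 *
        (exceed p.1 b (⌊N p.2⌋₊ + 1) 0).indicator 1 ω)
      (s := (Finset.univ.erase b) ×ˢ Finset.Icc 2 K) (a := (a, k))
      (fun p _ => mul_nonneg (le_max_right _ _) (Set.indicator_nonneg (fun _ _ => zero_le_one) _))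
      (by simp [hab, h2, hk ▸ card_survivors_le _])
    simp only [Set.indicator_of_mem h3, Pi.one_apply, mul_one] at h4
    have h5 := le_max_left (gap ν a - x k) 0
    change _ ≤ tailSum N ν b x ω at h4
    linarith
  · refine ⟨0, le_rfl, Or.inl rfl, sum_recommendProb_mul_le (by omega) ν fun a ha => ?_⟩
    have h1 : k = 1 := by
      have : 0 < k := Finset.card_pos.2 ⟨b, hmem⟩
      omega
    obtain ⟨d, hd⟩ := Finset.card_eq_one.1 h1
    rw [leaders, Finset.mem_filter] at ha
    have hab : a = b := by
      have h5 := ha.1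
      rw [hd, Finset.mem_singleton] at h5 hmem
      rw [h5, hmem]
    rw [hab, hb]
    linarith

/-- The number of suboptimal arms and epochs `n ≤ M` that pass the elimination test. -/
noncomputable def passCount (σ δ : ℝ) (M : ℕ) (b : Fin K) (ω : Fin K × ℕ → ℝ) : ℝ :=
  ∑ p ∈ (Finset.univ.erase b) ×ˢ Finset.Icc 1 M,
    (exceed p.1 b p.2 (-width K σ δ p.2)).indicator 1 ω

/-- A survivor of epoch n was compared with `b`, which was still present, and was not eliminated by
it. -/
theorem sum_card_survivors_le_passCount {b : Fin K} {M T : ℕ} (hTM : T ≤ M)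
    (hb : ∀ n, n ≤ M → b ∈ survivors σ δ ω n) :
    ∑ n ∈ Finset.Icc 1 T, (((survivors σ δ ω n).card : ℝ) - 1) ≤ passCount σ δ M b ω := by
  unfold passCount
  rw [Finset.sum_product_right]
  refine (Finset.sum_le_sum fun n hn => ?_).trans (Finset.sum_le_sum_of_subset_of_nonneg
    (Finset.Icc_subset_Icc_right hTM) fun n _ _ => ?_)
  · rw [Finset.mem_Icc] at hn
    have h1 : ((survivors σ δ ω n).card : ℝ) - 1 = ((survivors σ δ ω n).erase b).card := by
      rw [Finset.card_erase_of_mem (hb n (by omega)), Nat.cast_sub]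
      · simp
      · exact Finset.card_pos.2 ⟨b, hb n (by omega)⟩
    rw [h1, Finset.cast_card]
    refine (Finset.sum_le_sum fun a ha => ?_).trans (Finset.sum_le_sum_of_subset_of_nonneg
      (Finset.erase_subset_erase b (Finset.subset_univ _)) fun a _ _ =>
        Set.indicator_nonneg (fun _ _ => zero_le_one) _)
    have h2 : ω ∈ exceed a b n (-width K σ δ n) := by
      have h3 := Finset.mem_of_mem_erase ha
      obtain ⟨t, rfl⟩ : ∃ t, n = t + 1 := ⟨n - 1, by omega⟩
      rw [survivors, Finset.mem_filter] at h3
      have h4 := h3.2 b (hb t (by omega))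
      change -width K σ δ (t + 1) ≤ empMean ω a (t + 1) - empMean ω b (t + 1)
      linarith
    simp [Set.indicator_of_mem h2]
  · exact Finset.sum_nonneg fun a _ => Set.indicator_nonneg (fun _ _ => zero_le_one) _

/-- While the loop runs |S| ≥ 2, so |S| ≤ 2 (|S| - 1). -/
theorem totalPulls_le_passCount {b : Fin K} {M : ℕ} (hTM : epochs N σ δ ω ≤ M)
    (hpos : 0 < epochs N σ δ ω) (hb : ∀ n, n ≤ M → b ∈ survivors σ δ ω n) :
    (totalPulls N σ δ ω : ℝ) ≤ K + 2 * passCount σ δ M b ω := by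
  rw [totalPulls_eq hpos]
  push_cast
  gcongr
  refine le_trans ?_ (mul_le_mul_of_nonneg_left
    (sum_card_survivors_le_passCount (T := epochs N σ δ ω - 1) (by omega) hb) zero_le_two)
  rw [Finset.mul_sum]
  refine Finset.sum_le_sum fun n hn => ?_
  rw [Finset.mem_Icc] at hn
  have h1 := (continues_of_lt_epochs (N := N) (σ := σ) (δ := δ) (ω := ω)
      (n := n) (by omega)).2
  have h2 : (2 : ℝ) ≤ (survivors σ δ ω n).card := by exact_mod_cast h1
  linarith

/-- Survivor sets only shrink, so every final survivor other than `b` has passed all the tests. This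
is what allows the regret threshold to be charged to the passes. -/
theorem epochs_mul_card_le_passCount {b : Fin K} {M : ℕ} (hTM : epochs N σ δ ω ≤ M)
    (hb : ∀ n, n ≤ M → b ∈ survivors σ δ ω n) :
    (epochs N σ δ ω : ℝ) * ((survivors σ δ ω (epochs N σ δ ω)).card - 1) ≤
      passCount σ δ M b ω := by
  refine le_trans ?_ (sum_card_survivors_le_passCount hTM hb)
  rw [show (epochs N σ δ ω : ℝ) * ((survivors σ δ ω (epochs N σ δ ω)).card - 1) =
    ∑ n ∈ Finset.Icc 1 (epochs N σ δ ω),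
      (((survivors σ δ ω (epochs N σ δ ω)).card : ℝ) - 1) by
      rw [Finset.sum_const, Nat.card_Icc, nsmul_eq_mul, Nat.add_sub_cancel]]
  refine Finset.sum_le_sum fun n hn => ?_
  rw [Finset.mem_Icc] at hn
  have := Finset.card_le_card (survivors_antitone σ δ ω hn.2)
  have h2 : ((survivors σ δ ω (epochs N σ δ ω)).card : ℝ) ≤ (survivors σ δ ω n).card := by
    exact_mod_cast this
  linarith

/-! ### Integration of the pointwise bounds -/

theorem gap_nonneg (ν : Model K) (a : Fin K) : 0 ≤ gap ν a :=
  sub_nonneg.2 (le_ciSup (f := mean ν) (Set.finite_range _).bddAbove a)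

theorem mean_sub_mean_eq_gap {ν : Model K} {b : Fin K} (hb : gap ν b = 0) (a : Fin K) :
    mean ν b - mean ν a = gap ν a := by
  unfold gap at *
  linarith

theorem tableLaw_exceed_le {ν : Model K} (hσ : 0 < σ)
    (hsub : ∀ a, IsSubGaussian σ (ν a : Measure ℝ)) {a b : Fin K} (hb : gap ν b = 0)
    (hab : a ≠ b) {n : ℕ} (hn : 0 < n) {y : ℝ} (hy : 0 ≤ y + gap ν a) :
    tableLaw ν (exceed a b n y) ≤
      ENNReal.ofReal (Real.exp (-(n * (y + gap ν a) ^ 2 / (4 * σ ^ 2)))) := by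
  have h := tableLaw_le_empMean_sub ν hσ hsub hab hn (y := y)
    (by rwa [mean_sub_mean_eq_gap hb])
  rwa [mean_sub_mean_eq_gap hb] at h

/-- The maximum with 0 reflects that `Real.sqrt` vanishes at negative arguments. -/
theorem mul_width_sq (hσ : 0 < σ) {n : ℕ} (hn : 0 < n) :
    n * width K σ δ n ^ 2 / (4 * σ ^ 2) = max (Real.log (K * n * δ⁻¹)) 0 := by
  have hn' : (0 : ℝ) < n := by exact_mod_cast hn
  unfold width
  rcases le_total 0 (Real.log (K * n * δ⁻¹)) with h | h
  · rw [Real.sq_sqrt (by positivity), max_eq_left h]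
    field_simp
  · rw [Real.sqrt_eq_zero_of_nonpos, max_eq_right h]
    · simp
    · exact mul_nonpos_of_nonneg_of_nonpos (by positivity) h

/-- (w + Δ)² ≥ w² + Δ²: the w² part gives δ/(Kn). The Δ² factor is kept because it makes the sum
over n at most a multiple of σ²/Δ². -/
theorem tableLaw_exceed_width_le {ν : Model K} (hσ : 0 < σ) (hδ : 0 < δ)
    (hsub : ∀ a, IsSubGaussian σ (ν a : Measure ℝ)) {a b : Fin K} (hb : gap ν b = 0)
    (hab : a ≠ b) {n : ℕ} (hn : 0 < n) :
    tableLaw ν (exceed a b n (width K σ δ n)) ≤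
      ENNReal.ofReal (δ / (K * n) * Real.exp (-(n * gap ν a ^ 2 / (4 * σ ^ 2)))) := by
  have hw : 0 ≤ width K σ δ n := Real.sqrt_nonneg _
  have hg := gap_nonneg ν a
  have hn' : (0 : ℝ) < n := by exact_mod_cast hn
  have hK : (0 : ℝ) < K := by exact_mod_cast a.pos
  refine (tableLaw_exceed_le hσ hsub hb hab hn (by positivity)).trans
    (ENNReal.ofReal_le_ofReal ?_)
  have h1 : δ / (K * n) = Real.exp (-Real.log (K * n * δ⁻¹)) := by
    rw [← Real.log_inv, Real.exp_log (by positivity)]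
    field_simp
  rw [h1, ← Real.exp_add]
  apply Real.exp_le_exp.2
  have h2 := mul_width_sq (K := K) (δ := δ) hσ hn
  have h3 := le_max_left (Real.log (K * n * δ⁻¹)) 0
  have h4 : (n : ℝ) * (width K σ δ n + gap ν a) ^ 2 / (4 * σ ^ 2) =
      n * width K σ δ n ^ 2 / (4 * σ ^ 2) + n * gap ν a ^ 2 / (4 * σ ^ 2) +
        n * (2 * width K σ δ n * gap ν a) / (4 * σ ^ 2) := by ring
  have h5 : 0 ≤ n * (2 * width K σ δ n * gap ν a) / (4 * σ ^ 2) := by positivity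
  linarith

/-- Bound for the probability that an arm with gap `Δ` passes the elimination test of epoch `n`
if `Λ` dominates the logarithms in the confidence widths. -/
noncomputable def passBound (σ Λ Δ : ℝ) (n : ℕ) : ℝ :=
  min 1 (Real.exp (-(3 / 10 * (n * (Δ ^ 2 / (4 * σ ^ 2)) - Λ / (7 / 10)))))

/-- Completing the square separates gap and width: (Δ - w)² = 3/10 (Δ² - w²/(7/10)) + 7/10 (Δ -
10w/7)². If Δ < w the claimed bound is trivial, as the exponential is at least 1. -/
theorem tableLaw_exceed_neg_width_le {ν : Model K} (hσ : 0 < σ)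
    (hsub : ∀ a, IsSubGaussian σ (ν a : Measure ℝ)) {a b : Fin K} (hb : gap ν b = 0)
    (hab : a ≠ b) {n : ℕ} (hn : 0 < n) {Λ : ℝ} (hΛ0 : 0 ≤ Λ)
    (hΛ : Real.log (K * n * δ⁻¹) ≤ Λ) :
    tableLaw ν (exceed a b n (-width K σ δ n)) ≤ ENNReal.ofReal (passBound σ Λ (gap ν a) n) := by
  have hw : 0 ≤ width K σ δ n := Real.sqrt_nonneg _
  have hg := gap_nonneg ν a
  have hn' : (0 : ℝ) < n := by exact_mod_cast hn
  unfold passBound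
  rw [ENNReal.ofReal_min]
  refine le_min (by simpa using prob_le_one) ?_
  have h2 := mul_width_sq (K := K) (δ := δ) hσ hn
  have h3 : n * width K σ δ n ^ 2 / (4 * σ ^ 2) ≤ Λ := h2 ▸ max_le hΛ hΛ0
  by_cases h : 0 ≤ -width K σ δ n + gap ν a
  · refine (tableLaw_exceed_le hσ hsub hb hab hn h).trans (ENNReal.ofReal_le_ofReal ?_)
    apply Real.exp_le_exp.2
    have h4 : (n : ℝ) * (-width K σ δ n + gap ν a) ^ 2 / (4 * σ ^ 2) -
        3 / 10 * (n * (gap ν a ^ 2 / (4 * σ ^ 2)) -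
          n * width K σ δ n ^ 2 / (4 * σ ^ 2) / (7 / 10)) =
        n / (4 * σ ^ 2) * (7 / 10) * (gap ν a - 10 / 7 * width K σ δ n) ^ 2 := by ring
    have h5 : 0 ≤ n / (4 * σ ^ 2) * (7 / 10) * (gap ν a - 10 / 7 * width K σ δ n) ^ 2 := by
      positivity
    linarith
  · refine prob_le_one.trans ?_
    rw [← ENNReal.ofReal_one]
    refine ENNReal.ofReal_le_ofReal (Real.one_le_exp ?_)
    have h4 : n * (gap ν a ^ 2 / (4 * σ ^ 2)) ≤ n * width K σ δ n ^ 2 / (4 * σ ^ 2) := by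
      rw [mul_div_assoc]
      gcongr
      linarith
    linarith

/-- Common core of both regimes. `C₀` is the sure part of the loss, `Cp` the price of one passed
test, `Cb` the price of one failure of the confidence widths; `x` gives the regret thresholds. -/
theorem risk_le_of_forall {c : ℝ} (hc : 0 ≤ c) (hσ : 0 < σ) (hδ : 0 < δ) (hK : 2 ≤ K)
    (hN : ∀ k l, 2 ≤ k → k ≤ l → N l ≤ N k) (hN0 : ∀ k, 2 ≤ k → 0 ≤ N k)
    {ν : Model K} (hsub : ∀ a, IsSubGaussian σ (ν a : Measure ℝ)) {b : Fin K}
    (hb : gap ν b = 0) {B : ℝ} (hB : ∀ a, gap ν a ≤ B) {x : ℕ → ℝ} (hx : ∀ k, 0 ≤ x k)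
    {Λ : ℝ} (hΛ0 : 0 ≤ Λ)
    (hΛ : ∀ n : ℕ, 1 ≤ n → n ≤ ⌊N 2⌋₊ + 1 → Real.log (K * n * δ⁻¹) ≤ Λ)
    {C₀ Cp Cb : ℝ} (hC₀ : 0 ≤ C₀) (hCp : 0 ≤ Cp) (hCb : 0 ≤ Cb)
    (hgood : ∀ ω, (∀ n, n ≤ ⌊N 2⌋₊ + 1 → b ∈ survivors σ δ ω n) → ∀ z,
      (z = 0 ∨ (2 ≤ (survivors σ δ ω (epochs N σ δ ω)).card ∧
        z = x (survivors σ δ ω (epochs N σ δ ω)).card)) →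
      z + c * totalPulls N σ δ ω ≤ C₀ + Cp * passCount σ δ (⌊N 2⌋₊ + 1) b ω)
    (hbad : ∀ ω : Fin K × ℕ → ℝ, B + c * totalPulls N σ δ ω ≤ C₀ + Cb) :
    risk N σ δ c ν ≤ ENNReal.ofReal (C₀ +
      (∑ p ∈ (Finset.univ.erase b) ×ˢ Finset.Icc 1 (⌊N 2⌋₊ + 1),
          Cp * passBound σ Λ (gap ν p.1) p.2 +
        (∑ p ∈ (Finset.univ.erase b) ×ˢ Finset.Icc 2 K, max (gap ν p.1 - x p.2) 0 *
          Real.exp (-((⌊N p.2⌋₊ + 1 : ℕ) * gap ν p.1 ^ 2 / (4 * σ ^ 2))) +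
        ∑ p ∈ (Finset.univ.erase b) ×ˢ Finset.Icc 1 (⌊N 2⌋₊ + 1),
          Cb * (δ / (K * p.2) * Real.exp (-(p.2 * gap ν p.1 ^ 2 / (4 * σ ^ 2))))))) := by
  set M := ⌊N 2⌋₊ + 1 with hM
  set I₁ := (Finset.univ.erase b) ×ˢ Finset.Icc 1 M with hI₁
  set I₂ := (Finset.univ.erase b) ×ˢ Finset.Icc 2 K with hI₂
  have hmem₁ : ∀ p ∈ I₁, p.1 ≠ b ∧ 1 ≤ p.2 ∧ p.2 ≤ M := by
    intro p hp
    simpa [hI₁] using hp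
  have hmem₂ : ∀ p ∈ I₂, p.1 ≠ b ∧ 2 ≤ p.2 ∧ p.2 ≤ K := by
    intro p hp
    simpa [hI₂] using hp
  have hKpos : (0 : ℝ) < K := by exact_mod_cast (by omega : 0 < K)
  have key := lintegral_le_of_le_sum_indicator (tableLaw ν)
    (fun ω => (∑ a, recommendProb N σ δ ω a * ENNReal.ofReal (gap ν a))
      + ENNReal.ofReal c * (totalPulls N σ δ ω : ℝ≥0∞))
    (I₁.disjSum (I₂.disjSum I₁)) C₀
    (Sum.elim (fun _ => Cp) (Sum.elim (fun p => max (gap ν p.1 - x p.2) 0) (fun _ => Cb)))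
    (Sum.elim (fun p => passBound σ Λ (gap ν p.1) p.2)
      (Sum.elim (fun p => Real.exp (-((⌊N p.2⌋₊ + 1 : ℕ) * gap ν p.1 ^ 2 / (4 * σ ^ 2))))
        (fun p => δ / (K * p.2) * Real.exp (-(p.2 * gap ν p.1 ^ 2 / (4 * σ ^ 2))))))
    (Sum.elim (fun p => exceed p.1 b p.2 (-width K σ δ p.2))
      (Sum.elim (fun p => exceed p.1 b (⌊N p.2⌋₊ + 1) 0)
        (fun p => exceed p.1 b p.2 (width K σ δ p.2))))
    ?_ hC₀ ?_ ?_ ?_ ?_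
  · simp only [Finset.sum_disjSum, Sum.elim_inl, Sum.elim_inr] at key
    exact key
  · rintro (p | p | p) - <;> exact measurableSet_exceed _ _ _ _
  · rintro (p | p | p) -
    · exact hCp
    · exact le_max_right _ _
    · exact hCb
  · rintro (p | p | p) -
    · exact le_min zero_le_one (Real.exp_nonneg _)
    · exact Real.exp_nonneg _
    · simp only [Sum.elim_inr]
      positivity
  · rintro (p | p | p) hp
    · have h := hmem₁ p (by simpa using hp)
      exact tableLaw_exceed_neg_width_le hσ hsub hb h.1 (by omega) hΛ0 (hΛ _ h.2.1 h.2.2)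
    · have h := hmem₂ p (by simpa using hp)
      have := tableLaw_exceed_le hσ hsub hb h.1 (Nat.succ_pos ⌊N p.2⌋₊) (y := 0)
        (by simpa using gap_nonneg ν p.1)
      simpa using this
    · have h := hmem₁ p (by simpa using hp)
      exact tableLaw_exceed_width_le hσ hδ hsub hb h.1 (by omega)
  · intro ω
    simp only [Finset.sum_disjSum, Sum.elim_inl, Sum.elim_inr]
    have htp : ENNReal.ofReal c * (totalPulls N σ δ ω : ℝ≥0∞) =
        ENNReal.ofReal (c * totalPulls N σ δ ω) := by
      rw [ENNReal.ofReal_mul hc, ENNReal.ofReal_natCast]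
    have hpass : ∑ p ∈ I₁, Cp * (exceed p.1 b p.2 (-width K σ δ p.2)).indicator 1 ω =
        Cp * passCount σ δ M b ω := by
      rw [passCount, Finset.mul_sum]
    have hpass0 : 0 ≤ Cp * passCount σ δ M b ω := mul_nonneg hCp
      (Finset.sum_nonneg fun _ _ => Set.indicator_nonneg (fun _ _ => zero_le_one) _)
    have htail0 := tailSum_nonneg N ν b x ω
    have hind : ∀ p ∈ I₁, 0 ≤ Cb *
        (exceed p.1 b p.2 (width K σ δ p.2)).indicator (1 : (Fin K × ℕ → ℝ) → ℝ) ω := fun p _ =>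
      mul_nonneg hCb (Set.indicator_nonneg (fun _ _ => zero_le_one) _)
    rw [htp, hpass]
    change _ ≤ ENNReal.ofReal (C₀ + (Cp * passCount σ δ M b ω + (tailSum N ν b x ω +
      ∑ p ∈ I₁, Cb * (exceed p.1 b p.2 (width K σ δ p.2)).indicator 1 ω)))
    have hpulls : 0 ≤ c * (totalPulls N σ δ ω : ℝ) := by positivity
    -- On a good table `b` survives throughout; on any other table at least one indicator of weight
    -- `Cb` is on.
    by_cases hg : ∀ n, 1 ≤ n → n ≤ M → ∀ a, a ≠ b →
        empMean ω a n - empMean ω b n ≤ width K σ δ n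
    · have hsurv := mem_survivors_of_forall_le hg
      have hT : epochs N σ δ ω ≤ M := epochs_le hN
      obtain ⟨z, hz0, hz, hreg⟩ := sum_recommendProb_mul_le_tailSum hN hN0 hK ν hb hx
        (hsurv _ hT)
      refine (add_le_add_left hreg _).trans ?_
      rw [← ENNReal.ofReal_add (by positivity) hpulls]
      refine ENNReal.ofReal_le_ofReal ?_
      have h1 := hgood ω hsurv z hz
      have h2 := Finset.sum_nonneg hind
      linarith
    · push Not at hg
      obtain ⟨n, hn1, hnM, a, hab, hlt⟩ := hg
      have h1 : ω ∈ exceed a b n (width K σ δ n) := hlt.le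
      have h2 := Finset.single_le_sum hind (a := (a, n)) (by simp [hI₁, hab, hn1, hnM])
      simp only [Set.indicator_of_mem h1, Pi.one_apply, mul_one] at h2
      have h3 : 0 ≤ B := hb ▸ hB b
      refine (add_le_add_left (sum_recommendProb_mul_le (N := N) (σ := σ) (δ := δ) (ω := ω)
        (by omega) ν fun a _ => hB a) _).trans ?_
      rw [← ENNReal.ofReal_add h3 hpulls]
      refine ENNReal.ofReal_le_ofReal ?_
      have h4 := hbad ω
      linarith

/-- If the budget allows one epoch only, the recommended arm has the largest empirical mean. -/
theorem risk_le_of_budget_lt_one {c : ℝ} (hc : 0 ≤ c) (hσ : 0 < σ) (hK : 2 ≤ K)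
    (hN : ∀ k l, 2 ≤ k → k ≤ l → N l ≤ N k) (hN0 : ∀ k, 2 ≤ k → 0 ≤ N k) (hN2 : N 2 < 1)
    {ν : Model K} (hsub : ∀ a, IsSubGaussian σ (ν a : Measure ℝ)) {b : Fin K}
    (hb : gap ν b = 0) {x : ℝ} (hx : 0 ≤ x) :
    risk N σ δ c ν ≤ ENNReal.ofReal (c * K + x + ∑ a ∈ Finset.univ.erase b,
      max (gap ν a - x) 0 * Real.exp (-(gap ν a ^ 2 / (4 * σ ^ 2)))) := by
  refine lintegral_le_of_le_sum_indicator (tableLaw ν) _ (Finset.univ.erase b) (c * K + x)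
    (fun a => max (gap ν a - x) 0) (fun a => Real.exp (-(gap ν a ^ 2 / (4 * σ ^ 2))))
    (fun a => exceed a b 1 0) (fun a _ => measurableSet_exceed _ _ _ _) (by positivity)
    (fun a _ => le_max_right _ _) (fun a _ => Real.exp_nonneg _) ?_ ?_
  · intro a ha
    have := tableLaw_exceed_le hσ hsub hb (Finset.ne_of_mem_erase ha) one_pos (y := 0)
      (by simpa using gap_nonneg ν a)
    simpa using this
  · intro ω
    have hpos : 0 < epochs N σ δ ω := epochs_pos hK hN0
    have hT : epochs N σ δ ω = 1 := by
      have := epochs_le (σ := σ) (δ := δ) (ω := ω) hN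
      rw [(Nat.floor_eq_zero).2 hN2] at this
      omega
    have hpulls : totalPulls N σ δ ω = K := by
      rw [totalPulls_eq hpos, hT]
      simp
    have hlead : ∀ a ∈ leaders N σ δ ω, ω ∈ exceed a b 1 0 := by
      intro a ha
      rw [leaders, Finset.mem_filter, hT] at ha
      -- The overall empirical maximiser always passes the first test, so a leader beats `b` even if
      -- `b` was removed; no good event is needed.
      obtain ⟨d, -, hd⟩ := Finset.exists_max_image Finset.univ (fun l => empMean ω l 1)
        ⟨b, Finset.mem_univ b⟩
      have hdS : d ∈ survivors σ δ ω 1 := by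
        simp only [survivors, Finset.mem_filter, Finset.mem_univ, true_and, forall_const, zero_add]
        intro l
        have h1 := hd l (Finset.mem_univ l)
        have h2 : 0 ≤ width K σ δ 1 := Real.sqrt_nonneg _
        linarith
      have h3 := ha.2 d hdS
      have h4 := hd b (Finset.mem_univ b)
      change (0 : ℝ) ≤ empMean ω a 1 - empMean ω b 1
      linarith
    have hnn : ∀ a ∈ Finset.univ.erase b, 0 ≤ max (gap ν a - x) 0 *
        (exceed a b 1 0).indicator (1 : (Fin K × ℕ → ℝ) → ℝ) ω := fun a _ =>
      mul_nonneg (le_max_right _ _) (Set.indicator_nonneg (fun _ _ => zero_le_one) _)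
    have hreg := sum_recommendProb_mul_le (N := N) (σ := σ) (δ := δ) (ω := ω) (by omega) ν
      (y := x + ∑ a ∈ Finset.univ.erase b, max (gap ν a - x) 0 *
        (exceed a b 1 0).indicator 1 ω) (by
        intro a ha
        by_cases hab : a = b
        · rw [hab, hb]
          exact add_nonneg hx (Finset.sum_nonneg hnn)
        have h1 := Finset.single_le_sum hnn (a := a) (by simp [hab])
        simp only [Set.indicator_of_mem (hlead a ha), Pi.one_apply, mul_one] at h1
        have h2 := le_max_left (gap ν a - x) 0
        linarith)
    have htp : ENNReal.ofReal c * (totalPulls N σ δ ω : ℝ≥0∞) = ENNReal.ofReal (c * K) := by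
      rw [hpulls, ENNReal.ofReal_mul hc, ENNReal.ofReal_natCast]
    rw [htp]
    refine (add_le_add_left hreg _).trans ?_
    rw [← ENNReal.ofReal_add (add_nonneg hx (Finset.sum_nonneg hnn)) (by positivity)]
    refine ENNReal.ofReal_le_ofReal ?_
    linarith

end

/-! ### The budget function -/

theorem Nstar_pos {σ c : ℝ} (hσ : 0 < σ) (hc : 0 < c) {k : ℕ} (hk : 2 ≤ k) :
    0 < Nstar σ c k := by
  have : (0 : ℝ) < (k : ℝ) - 1 := by
    have : (2 : ℝ) ≤ k := by exact_mod_cast hk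
    linarith
  unfold Nstar
  positivity

/-- Cubing removes the fractional powers; later estimates on the budget are derived from this
polynomial identity. -/
theorem Nstar_pow_three {σ c : ℝ} (hσ : 0 < σ) (hc : 0 < c) {k : ℕ} (hk : 2 ≤ k) :
    Nstar σ c k ^ 3 * (((k : ℝ) - 1) * c) ^ 2 = (3 / (2 * Real.exp 1)) ^ 3 * σ ^ 2 := by
  have hk' : (0 : ℝ) < (k : ℝ) - 1 := by
    have : (2 : ℝ) ≤ k := by exact_mod_cast hk
    linarith
  have hy : 0 < ((k : ℝ) - 1) * c := by positivity
  unfold Nstar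
  have h1 : (σ ^ (2 / 3 : ℝ)) ^ 3 = σ ^ 2 := by
    rw [← Real.rpow_natCast, ← Real.rpow_mul hσ.le]
    norm_num
  have h2 : ((((k : ℝ) - 1) * c) ^ (-(2 / 3) : ℝ)) ^ 3 * (((k : ℝ) - 1) * c) ^ 2 = 1 := by
    rw [← Real.rpow_natCast, ← Real.rpow_natCast, ← Real.rpow_mul hy.le, ← Real.rpow_add hy]
    norm_num
  rw [mul_pow, mul_pow, h1, mul_assoc, h2, mul_one]

theorem Nstar_antitone {σ c : ℝ} (hσ : 0 < σ) (hc : 0 < c) (k l : ℕ) (hk : 2 ≤ k) (hkl : k ≤ l) :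
    Nstar σ c l ≤ Nstar σ c k := by
  have hk' : (2 : ℝ) ≤ k := by exact_mod_cast hk
  have hl' : (k : ℝ) ≤ l := by exact_mod_cast hkl
  unfold Nstar
  refine mul_le_mul_of_nonneg_left ?_ (by positivity)
  refine Real.rpow_le_rpow_of_nonpos (mul_pos (by linarith) hc) ?_ (by norm_num)
  gcongr

theorem conf_pos {K : ℕ} (hK : 2 ≤ K) {σ B c : ℝ} (hσ : 0 < σ) (hB : 0 < B) (hc : 0 < c) :
    0 < conf K σ B c := by
  have h1 := Nstar_pos hσ hc (le_refl 2)
  have h2 : 0 < Real.log K := Real.log_pos (by exact_mod_cast (by omega : 1 < K))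
  have h3 : (0 : ℝ) < K := by exact_mod_cast (by omega : 0 < K)
  unfold conf
  positivity

theorem conf_mul_le {K : ℕ} (hK : 2 ≤ K) {σ B c : ℝ} (hσ : 0 < σ) (hB : 0 < B) (hc : 0 < c) :
    B * conf K σ B c ≤ c := by
  have h1 := Nstar_pos hσ hc (le_refl 2)
  have h2 : 0 < Real.log K := Real.log_pos (by exact_mod_cast (by omega : 1 < K))
  have h3 : (0 : ℝ) < K := by exact_mod_cast (by omega : 0 < K)
  unfold conf
  rw [← mul_assoc, ← div_eq_mul_inv, div_le_iff₀ (by positivity)]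
  have : 0 ≤ Real.exp 1 * (K : ℝ) ^ (1 / 3 : ℝ) * Real.log K * Nstar σ c 2 := by positivity
  nlinarith

/-- The cube root of a nonnegative real number. -/
noncomputable def cbrt (x : ℝ) : ℝ := x ^ (1 / 3 : ℝ)

theorem cbrt_pow_three {x : ℝ} (hx : 0 ≤ x) : cbrt x ^ 3 = x := by
  unfold cbrt
  rw [← Real.rpow_natCast, ← Real.rpow_mul hx]
  norm_num

theorem cbrt_nonneg {x : ℝ} (hx : 0 ≤ x) : 0 ≤ cbrt x := Real.rpow_nonneg hx _

theorem cbrt_pos {x : ℝ} (hx : 0 < x) : 0 < cbrt x := Real.rpow_pos_of_pos hx _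

theorem cbrt_le_iff {x y : ℝ} (hx : 0 ≤ x) (hy : 0 ≤ y) : cbrt x ≤ y ↔ x ≤ y ^ 3 := by
  rw [← pow_le_pow_iff_left₀ (cbrt_nonneg hx) hy three_ne_zero, cbrt_pow_three hx]

theorem le_cbrt_iff {x y : ℝ} (hx : 0 ≤ x) (hy : 0 ≤ y) : y ≤ cbrt x ↔ y ^ 3 ≤ x := by
  rw [← pow_le_pow_iff_left₀ hy (cbrt_nonneg hx) three_ne_zero, cbrt_pow_three hx]

theorem cbrt_mul {x y : ℝ} (hx : 0 ≤ x) (hy : 0 ≤ y) : cbrt (x * y) = cbrt x * cbrt y :=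
  Real.mul_rpow hx hy

theorem cbrt_mono {x y : ℝ} (hx : 0 ≤ x) (hxy : x ≤ y) : cbrt x ≤ cbrt y :=
  Real.rpow_le_rpow hx hxy (by norm_num)

theorem mul_Nstar_mul_cbrt_sq {σ c : ℝ} (hσ : 0 < σ) (hc : 0 < c) {k : ℕ} (hk : 2 ≤ k) :
    c * Nstar σ c k * cbrt ((k : ℝ) - 1) ^ 2 = 3 / (2 * Real.exp 1) * cbrt (σ ^ 2 * c) := by
  have hk' : (0 : ℝ) < (k : ℝ) - 1 := by
    have : (2 : ℝ) ≤ k := by exact_mod_cast hk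
    linarith
  have hN := Nstar_pos hσ hc hk
  have hu := cbrt_pos (show 0 < σ ^ 2 * c by positivity)
  refine (pow_left_inj₀ (by positivity) (by positivity) three_ne_zero).1 ?_
  have h1 := cbrt_pow_three hk'.le
  have h2 := cbrt_pow_three (show 0 ≤ σ ^ 2 * c by positivity)
  have h3 := Nstar_pow_three hσ hc hk
  calc (c * Nstar σ c k * cbrt ((k : ℝ) - 1) ^ 2) ^ 3
      = c ^ 3 * Nstar σ c k ^ 3 * (cbrt ((k : ℝ) - 1) ^ 3) ^ 2 := by ring
    _ = c * (Nstar σ c k ^ 3 * (((k : ℝ) - 1) * c) ^ 2) := by rw [h1]; ring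
    _ = (3 / (2 * Real.exp 1)) ^ 3 * (σ ^ 2 * c) := by rw [h3]; ring
    _ = (3 / (2 * Real.exp 1) * cbrt (σ ^ 2 * c)) ^ 3 := by rw [mul_pow, h2]

theorem three_div_two_exp_le : 3 / (2 * Real.exp 1) ≤ 0.5519 := by
  have := Real.exp_one_gt_d9
  rw [div_le_iff₀ (by positivity)]
  nlinarith

theorem sum_inv_cbrt_sq_le (m : ℕ) (hm : 1 ≤ m) :
    ∑ k ∈ Finset.Icc 2 (m + 1), (cbrt ((k : ℝ) - 1) ^ 2)⁻¹ ≤ 3 * cbrt m - 2 := by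
  induction m, hm using Nat.le_induction with
  | base => norm_num [cbrt]
  | succ m hm ih =>
    rw [Finset.sum_Icc_succ_top (by omega)]
    have hm' : (0 : ℝ) < m := by exact_mod_cast hm
    have ha : 0 < cbrt ((m : ℝ) + 1) := cbrt_pos (by positivity)
    have hb : 0 < cbrt (m : ℝ) := cbrt_pos hm'
    have h1 := cbrt_pow_three hm'.le
    have h2 := cbrt_pow_three (show 0 ≤ (m : ℝ) + 1 by positivity)
    have hab : cbrt (m : ℝ) ≤ cbrt ((m : ℝ) + 1) := cbrt_mono hm'.le (by linarith)
    push_cast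
    rw [add_sub_cancel_right]
    -- With a³ - b³ = 1 and b ≤ a one has 1 = (a - b)(a² + ab + b²) ≤ 3a²(a - b).
    have key : (cbrt ((m : ℝ) + 1) ^ 2)⁻¹ ≤ 3 * (cbrt ((m : ℝ) + 1) - cbrt m) := by
      rw [inv_le_iff_one_le_mul₀ (by positivity)]
      have h3 : cbrt ((m : ℝ) + 1) ^ 3 - cbrt m ^ 3 = 1 := by rw [h1, h2]; ring
      generalize cbrt ((m : ℝ) + 1) = a at *
      generalize cbrt (m : ℝ) = b at *
      have h4 : 0 ≤ (a - b) * (2 * a ^ 2 - a * b - b ^ 2) := by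
        apply mul_nonneg (by linarith)
        nlinarith
      nlinarith
    linarith

/-- The budgets add up to at most `(3 (K-1)^{1/3} - 1) N*(2)`. -/
theorem Nstar_two_add_sum_le {σ c : ℝ} (hσ : 0 < σ) (hc : 0 < c) {K : ℕ} (hK : 2 ≤ K) :
    c * (Nstar σ c 2 + ∑ k ∈ Finset.Icc 2 K, Nstar σ c k) ≤
      3 / (2 * Real.exp 1) * cbrt (σ ^ 2 * c) * (3 * cbrt ((K : ℝ) - 1) - 1) := by
  have hform : ∀ k, 2 ≤ k → c * Nstar σ c k =
      3 / (2 * Real.exp 1) * cbrt (σ ^ 2 * c) * (cbrt ((k : ℝ) - 1) ^ 2)⁻¹ := by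
    intro k hk
    have hk' : (0 : ℝ) < (k : ℝ) - 1 := by
      have : (2 : ℝ) ≤ k := by exact_mod_cast hk
      linarith
    have := cbrt_pos hk'
    rw [← mul_Nstar_mul_cbrt_sq hσ hc hk]
    field_simp
  have h2 : c * Nstar σ c 2 = 3 / (2 * Real.exp 1) * cbrt (σ ^ 2 * c) := by
    rw [hform 2 le_rfl]
    norm_num [cbrt]
  have hsum := sum_inv_cbrt_sq_le (K - 1) (by omega)
  rw [Nat.sub_add_cancel (by omega), Nat.cast_sub (by omega), Nat.cast_one] at hsum
  rw [mul_add, Finset.mul_sum, h2, Finset.sum_congr rfl fun k hk =>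
    hform k (Finset.mem_Icc.1 hk).1, ← Finset.mul_sum]
  have hu := cbrt_nonneg (show 0 ≤ σ ^ 2 * c by positivity)
  have h3 : 0 ≤ 3 / (2 * Real.exp 1) * cbrt (σ ^ 2 * c) := by positivity
  nlinarith

/-- The scale `σ / √n_k` of the difference of two empirical means after `n_k = ⌊N*(k)⌋ + 1`
epochs, when the loop ends with `k` arms. -/
noncomputable def scale (σ c : ℝ) (k : ℕ) : ℝ := σ / Real.sqrt (⌊Nstar σ c k⌋₊ + 1 : ℕ)

theorem scale_pos {σ : ℝ} (hσ : 0 < σ) (c : ℝ) (k : ℕ) : 0 < scale σ c k := by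
  unfold scale
  positivity

theorem scale_sq {σ : ℝ} (c : ℝ) (k : ℕ) :
    scale σ c k ^ 2 = σ ^ 2 / (⌊Nstar σ c k⌋₊ + 1 : ℕ) := by
  unfold scale
  rw [div_pow, Real.sq_sqrt (by positivity)]

theorem exp_scale {σ : ℝ} (hσ : 0 < σ) (c : ℝ) (k : ℕ) (D : ℝ) :
    Real.exp (-((⌊Nstar σ c k⌋₊ + 1 : ℕ) * D ^ 2 / (4 * σ ^ 2))) =
      Real.exp (-(D / scale σ c k) ^ 2 / 4) := by
  rw [div_pow, scale_sq]
  congr 1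
  field_simp

theorem Nstar_lt_floor_add_one (σ c : ℝ) (k : ℕ) :
    Nstar σ c k < (⌊Nstar σ c k⌋₊ + 1 : ℕ) := by
  push_cast
  exact Nat.lt_floor_add_one _

theorem scale_le {σ c : ℝ} (hσ : 0 < σ) (hc : 0 < c) {k : ℕ} (hk : 2 ≤ k) :
    scale σ c k ≤ 1.3463 * cbrt ((k : ℝ) - 1) * cbrt (σ ^ 2 * c) := by
  have hk' : (0 : ℝ) < (k : ℝ) - 1 := by
    have : (2 : ℝ) ≤ k := by exact_mod_cast hk
    linarith
  have hr := cbrt_pos hk'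
  have hu := cbrt_pos (show 0 < σ ^ 2 * c by positivity)
  refine le_of_sq_le_sq ?_ (by positivity)
  rw [scale_sq]
  have hN := Nstar_pos hσ hc hk
  refine (div_le_div_of_nonneg_left (by positivity) hN
    (Nstar_lt_floor_add_one σ c k).le).trans ?_
  rw [div_le_iff₀ hN]
  have h1 := mul_Nstar_mul_cbrt_sq hσ hc hk
  have h2 := cbrt_pow_three (show 0 ≤ σ ^ 2 * c by positivity)
  refine le_of_mul_le_mul_left ?_ hc
  calc c * σ ^ 2 = cbrt (σ ^ 2 * c) ^ 3 := by rw [h2]; ring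
    -- 1.3463 is slightly more than (2e/3)^{1/2}.
    _ ≤ 1.3463 ^ 2 * cbrt (σ ^ 2 * c) ^ 2 * (3 / (2 * Real.exp 1) * cbrt (σ ^ 2 * c)) := by
      have he := Real.exp_one_lt_d9
      have h3 : (1 : ℝ) ≤ 1.3463 ^ 2 * (3 / (2 * Real.exp 1)) := by
        rw [← mul_div_assoc, le_div_iff₀ (by positivity)]
        nlinarith
      calc cbrt (σ ^ 2 * c) ^ 3 = 1 * cbrt (σ ^ 2 * c) ^ 3 := by ring
        _ ≤ 1.3463 ^ 2 * (3 / (2 * Real.exp 1)) * cbrt (σ ^ 2 * c) ^ 3 := by gcongr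
        _ = _ := by ring
    _ = _ := by rw [← h1]; ring

/-- The scale is bounded by the cost `c n_k (k - 1)` of `n_k` epochs with `k - 1` arms. -/
theorem scale_le_mul {σ c : ℝ} (hσ : 0 < σ) (hc : 0 < c) {k : ℕ} (hk : 2 ≤ k) :
    scale σ c k ≤ 2.44 * c * ((⌊Nstar σ c k⌋₊ + 1 : ℕ) * ((k : ℝ) - 1)) := by
  have hk' : (0 : ℝ) < (k : ℝ) - 1 := by
    have : (2 : ℝ) ≤ k := by exact_mod_cast hk
    linarith
  have hN := Nstar_pos hσ hc hk
  have hlt := Nstar_lt_floor_add_one σ c k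
  set n : ℝ := ((⌊Nstar σ c k⌋₊ + 1 : ℕ) : ℝ) with hn
  have hn0 : 0 < n := hN.trans hlt
  refine le_of_sq_le_sq ?_ (by positivity)
  rw [scale_sq, ← hn, div_le_iff₀ hn0]
  have h1 := Nstar_pow_three hσ hc hk
  have he := Real.exp_one_lt_d9
  -- 2.44 is slightly more than (2e/3)^{3/2}.
  have h3 : (1 : ℝ) ≤ 2.44 ^ 2 * (3 / (2 * Real.exp 1)) ^ 3 := by
    rw [div_pow, ← mul_div_assoc, le_div_iff₀ (by positivity), mul_pow]
    have : Real.exp 1 ^ 3 ≤ 2.7182818286 ^ 3 := by gcongr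
    nlinarith
  calc σ ^ 2 = 1 * σ ^ 2 := by ring
    _ ≤ 2.44 ^ 2 * (3 / (2 * Real.exp 1)) ^ 3 * σ ^ 2 := by gcongr
    _ = 2.44 ^ 2 * (Nstar σ c k ^ 3 * (((k : ℝ) - 1) * c) ^ 2) := by rw [h1]; ring
    _ ≤ 2.44 ^ 2 * (n ^ 3 * (((k : ℝ) - 1) * c) ^ 2) := by gcongr
    _ = _ := by ring

/-- In the product of `scale_le_mul` with scale² = σ²/n_k the epoch count cancels. -/
theorem scale_pow_three_le {σ c : ℝ} (hσ : 0 < σ) (hc : 0 < c) {k : ℕ} (hk : 2 ≤ k) :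
    scale σ c k ^ 3 ≤ 2.44 * (σ ^ 2 * c) * ((k : ℝ) - 1) := by
  have hk' : (0 : ℝ) < (k : ℝ) - 1 := by
    have : (2 : ℝ) ≤ k := by exact_mod_cast hk
    linarith
  have h1 := scale_le_mul hσ hc hk
  have h2 := scale_sq (σ := σ) c k
  calc scale σ c k ^ 3 = scale σ c k * scale σ c k ^ 2 := by ring
    _ ≤ 2.44 * c * ((⌊Nstar σ c k⌋₊ + 1 : ℕ) * ((k : ℝ) - 1)) * scale σ c k ^ 2 := by gcongr
    _ = _ := by rw [h2]; field_simp

/-! ### Elementary inequalities -/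

theorem mul_exp_neg_sq_le {y : ℝ} : y * Real.exp (-y ^ 2 / 4) ≤ 1 := by
  have h1 := Real.add_one_le_exp (y ^ 2 / 4)
  have h2 : y ≤ Real.exp (y ^ 2 / 4) := by nlinarith [sq_nonneg (y / 2 - 1)]
  rw [neg_div, Real.exp_neg, ← div_eq_mul_inv, div_le_one (Real.exp_pos _)]
  exact h2

theorem mul_exp_neg_le {t a : ℝ} (ha : 0 < a) : t * Real.exp (-(a * t)) ≤ 1 / (Real.exp 1 * a) := by
  have h1 := Real.add_one_le_exp (a * t - 1)
  rw [le_div_iff₀ (by positivity)]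
  have h2 : Real.exp (a * t - 1) * Real.exp 1 * Real.exp (-(a * t)) = 1 := by
    rw [← Real.exp_add, ← Real.exp_add]
    simp
  have h3 : 0 < Real.exp 1 * Real.exp (-(a * t)) := by positivity
  nlinarith

/-- Since y² ≥ θ² + 2θ(y - θ), beyond θ the Gaussian is dominated by an exponential of rate θ/2. -/
theorem max_sub_mul_exp_le {θ : ℝ} (hθ : 0 < θ) (y : ℝ) :
    max (y - θ) 0 * Real.exp (-y ^ 2 / 4) ≤ 2 * Real.exp (-θ ^ 2 / 4) / (Real.exp 1 * θ) := by
  rcases le_total y θ with h | h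
  · rw [max_eq_right (by linarith), zero_mul]
    positivity
  · rw [max_eq_left (by linarith)]
    have h1 := mul_exp_neg_le (t := y - θ) (half_pos hθ)
    have h2 : Real.exp (-y ^ 2 / 4) ≤ Real.exp (-θ ^ 2 / 4) * Real.exp (-(θ / 2 * (y - θ))) := by
      rw [← Real.exp_add]
      apply Real.exp_le_exp.2
      nlinarith [sq_nonneg (y - θ)]
    calc (y - θ) * Real.exp (-y ^ 2 / 4)
        ≤ (y - θ) * (Real.exp (-θ ^ 2 / 4) * Real.exp (-(θ / 2 * (y - θ)))) := by
          gcongr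
      _ = Real.exp (-θ ^ 2 / 4) * ((y - θ) * Real.exp (-(θ / 2 * (y - θ)))) := by ring
      _ ≤ Real.exp (-θ ^ 2 / 4) * (1 / (Real.exp 1 * (θ / 2))) := by gcongr
      _ = _ := by field_simp

theorem max_sub_mul_sq_mul_exp_le {θ : ℝ} (hθ : 2 ≤ θ) {y : ℝ} :
    max (y - θ) 0 * y ^ 2 * Real.exp (-y ^ 2 / 4) ≤
      4 * θ * Real.exp (-θ ^ 2 / 4) / Real.exp 1 := by
  rcases le_total y θ with h | h
  · rw [max_eq_right (by linarith), zero_mul, zero_mul]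
    positivity
  · rw [max_eq_left (by linarith)]
    obtain ⟨t, rfl⟩ : ∃ t, y = θ + t := ⟨y - θ, by ring⟩
    have ht : 0 ≤ t := by linarith
    rw [add_sub_cancel_left]
    have h1 := mul_exp_neg_le (t := t) (show 0 < θ / 2 by linarith)
    have h2 : Real.exp (-(θ + t) ^ 2 / 4) =
        Real.exp (-θ ^ 2 / 4) * Real.exp (-(θ / 2 * t)) * Real.exp (-(t ^ 2 / 4)) := by
      rw [← Real.exp_add, ← Real.exp_add]
      congr 1
      ring
    have h3 : (θ + t) ^ 2 * Real.exp (-(t ^ 2 / 4)) ≤ 2 * θ ^ 2 := by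
      have h4 := Real.add_one_le_exp (t ^ 2 / 4)
      rw [Real.exp_neg, ← div_eq_mul_inv, div_le_iff₀ (Real.exp_pos _)]
      -- Here θ ≥ 2 is needed.
      have h5 : θ + t ≤ θ * (1 + t / 2) := by nlinarith
      calc (θ + t) ^ 2 ≤ (θ * (1 + t / 2)) ^ 2 := by gcongr
        _ ≤ 2 * θ ^ 2 * (t ^ 2 / 4 + 1) := by nlinarith [mul_nonneg (sq_nonneg θ) (sq_nonneg (t - 2))]
        _ ≤ _ := by gcongr
    calc t * (θ + t) ^ 2 * Real.exp (-(θ + t) ^ 2 / 4)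
        = Real.exp (-θ ^ 2 / 4) * (t * Real.exp (-(θ / 2 * t))) *
            ((θ + t) ^ 2 * Real.exp (-(t ^ 2 / 4))) := by rw [h2]; ring
      _ ≤ Real.exp (-θ ^ 2 / 4) * (1 / (Real.exp 1 * (θ / 2))) * (2 * θ ^ 2) := by gcongr
      _ = _ := by field_simp; norm_num

theorem pow_three_mul_exp_le (y : ℝ) : y ^ 3 * Real.exp (-y ^ 2 / 4) ≤ 4 := by
  have h0 : 0 ≤ y ^ 2 / 4 := by positivity
  have h1 : 1 + y ^ 2 / 4 + (y ^ 2 / 4) ^ 2 / 2 + (y ^ 2 / 4) ^ 3 / 6 ≤ Real.exp (y ^ 2 / 4) := by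
    have := Real.sum_le_exp_of_nonneg h0 4
    simp [Finset.sum_range_succ, Nat.factorial] at this
    linarith
  rw [neg_div, Real.exp_neg, ← div_eq_mul_inv, div_le_iff₀ (Real.exp_pos _)]
  -- The right side is four times the Taylor polynomial above.
  have h2 : y ^ 3 ≤ 4 + y ^ 2 + y ^ 4 / 8 + y ^ 6 / 96 := by
    nlinarith [sq_nonneg (y ^ 3 / 10 - y), sq_nonneg (y ^ 2 - 7), sq_nonneg (y ^ 3 - 5 * y ^ 2),
      sq_nonneg (y - 2), sq_nonneg (y ^ 2 - 5 / 2 * y), sq_nonneg (y ^ 2 - 2 * y)]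
  nlinarith

/-- A linear bound is enough: multiplied by c, the term x/2 becomes c N*(2)/2, which is of order
(σ²c)^{1/3}. -/
theorem sum_Icc_inv_le {x : ℝ} (hx : 0 ≤ x) :
    ∑ n ∈ Finset.Icc 1 (⌊x⌋₊ + 1), (n : ℝ)⁻¹ ≤ 1 + x / 2 := by
  have h : ∀ M : ℕ, ∑ n ∈ Finset.Icc 1 (M + 1), (n : ℝ)⁻¹ ≤ 1 + (M : ℝ) / 2 := by
    intro M
    induction M with
    | zero => simp
    | succ M ih =>
      rw [Finset.sum_Icc_succ_top (by omega)]
      have : ((M + 1 + 1 : ℕ) : ℝ)⁻¹ ≤ 1 / 2 := by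
        rw [inv_le_comm₀ (by positivity) (by norm_num)]
        push_cast
        have : (0 : ℝ) ≤ M := by positivity
        linarith
      push_cast at *
      linarith
  have := Nat.floor_le hx
  linarith [h ⌊x⌋₊]

/-! ### The gap-independent bound -/

theorem sqrt_mem_Icc {L lo hi : ℝ} (hlo : lo ^ 2 ≤ L) (hhi : L ≤ hi ^ 2)
    (hi0 : 0 ≤ hi) : lo ≤ Real.sqrt L ∧ Real.sqrt L ≤ hi :=
  ⟨Real.le_sqrt_of_sq_le hlo, (Real.sqrt_le_left hi0).2 hhi⟩

/-- The threshold `√L` with `e^L = K (K-1) / 2`. -/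
noncomputable def sqrtLogPairs (K : ℕ) : ℝ := Real.sqrt (Real.log (K * (K - 1) / 2))

theorem three_le_pairs {K : ℕ} (hK : 3 ≤ K) : (3 : ℝ) ≤ K * (K - 1) / 2 := by
  have : (3 : ℝ) ≤ K := by exact_mod_cast hK
  nlinarith

theorem sqrtLogPairs_sq {K : ℕ} (hK : 3 ≤ K) :
    sqrtLogPairs K ^ 2 = Real.log (K * (K - 1) / 2) :=
  Real.sq_sqrt (Real.log_nonneg (by linarith [three_le_pairs hK]))

theorem one_le_sqrtLogPairs {K : ℕ} (hK : 3 ≤ K) : 1 ≤ sqrtLogPairs K := by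
  refine Real.le_sqrt_of_sq_le ?_
  have h1 := Real.log_le_log (by norm_num) (three_le_pairs hK)
  have h2 := Real.log_three_gt_d9
  norm_num
  linarith

theorem sqrtLogPairs_sq_le {K : ℕ} (hK : 3 ≤ K) :
    sqrtLogPairs K ^ 2 ≤ 2 * Real.log K - Real.log 2 := by
  have hK' : (3 : ℝ) ≤ K := by exact_mod_cast hK
  have h3 := three_le_pairs hK
  rw [sqrtLogPairs_sq hK]
  calc Real.log (K * (K - 1) / 2) ≤ Real.log ((K : ℝ) ^ 2 / 2) :=
        Real.log_le_log (by linarith) (by nlinarith)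
    _ = _ := by
        rw [Real.log_div (by positivity) (by norm_num), Real.log_pow]
        norm_num

theorem log_six_gt : 1.7917 < Real.log 6 := by
  rw [show (6 : ℝ) = 2 * 3 by norm_num, Real.log_mul (by norm_num) (by norm_num)]
  linarith [Real.log_two_gt_d9, Real.log_three_gt_d9]

theorem log_six_lt : Real.log 6 < 1.7918 := by
  rw [show (6 : ℝ) = 2 * 3 by norm_num, Real.log_mul (by norm_num) (by norm_num)]
  linarith [Real.log_two_lt_d9, Real.log_three_lt_d9]

theorem log_four_gt : 1.3862 < Real.log 4 := by
  rw [show (4 : ℝ) = 2 * 2 by norm_num, Real.log_mul (by norm_num) (by norm_num)]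
  linarith [Real.log_two_gt_d9]

/-- The left side grows like √(log K), since s² ≤ 2 log K - log 2. For K ≥ 6 this reduces to a
quadratic inequality in s; K = 3, 4, 5 are checked numerically. -/
theorem cost_add_regret_le_log_mul_cbrt {K : ℕ} (hK : 3 ≤ K) :
    1.6557 * cbrt ((K : ℝ) - 1) - 0.2759 + 1.3463 * cbrt ((K : ℝ) - 1) *
      (2 * sqrtLogPairs K + 0.736 * (((K : ℝ) - 1) / K) / sqrtLogPairs K) ≤
      4 * Real.log K * cbrt K := by
  have aux : ∀ (s r lo hi rhi f : ℝ), 0 < lo → lo ≤ s → s ≤ hi → 0 ≤ r → r ≤ rhi → 0 ≤ f →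
      1.6557 * r + 1.3463 * r * (2 * s + 0.736 * f / s) ≤
        1.6557 * rhi + 1.3463 * rhi * (2 * hi + 0.736 * f / lo) := by
    intro s r lo hi rhi f h1 h2 h3 h4 h5 h6
    have : 0 < s := by linarith
    have : 0 ≤ rhi := by linarith
    have : 0.736 * f / s ≤ 0.736 * f / lo := by gcongr
    gcongr
  have hs1 := one_le_sqrtLogPairs hK
  rcases (by omega : K = 3 ∨ K = 4 ∨ K = 5 ∨ 6 ≤ K) with rfl | rfl | rfl | h6
  · have hs : 1.0481 ≤ sqrtLogPairs 3 ∧ sqrtLogPairs 3 ≤ 1.0482 := by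
      have h1 := Real.log_three_gt_d9
      have h2 := Real.log_three_lt_d9
      apply sqrt_mem_Icc <;> norm_num <;> linarith
    have hr : cbrt ((3 : ℕ) - 1 : ℝ) ≤ 1.26 := (cbrt_le_iff (by norm_num) (by norm_num)).2
      (by norm_num)
    have hr0 : 0 ≤ cbrt ((3 : ℕ) - 1 : ℝ) := cbrt_nonneg (by norm_num)
    have hR : 1.4422 ≤ cbrt ((3 : ℕ) : ℝ) := (le_cbrt_iff (by norm_num) (by norm_num)).2
      (by norm_num)
    have hq : 1.0986 ≤ Real.log ((3 : ℕ) : ℝ) := by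
      push_cast
      linarith [Real.log_three_gt_d9]
    have h1 := aux _ _ _ _ _ (((3 : ℕ) - 1 : ℝ) / (3 : ℕ)) (by norm_num) hs.1 hs.2 hr0 hr
      (by norm_num)
    have h2 : (4 : ℝ) * 1.0986 * 1.4422 ≤ 4 * Real.log ((3 : ℕ) : ℝ) * cbrt ((3 : ℕ) : ℝ) := by
      gcongr
    norm_num at h1 h2 ⊢
    linarith
  · have hs : 1.3385 ≤ sqrtLogPairs 4 ∧ sqrtLogPairs 4 ≤ 1.3386 := by
      have h1 := log_six_gt
      have h2 := log_six_lt
      apply sqrt_mem_Icc <;> norm_num at h1 h2 ⊢ <;> linarith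
    have hr : cbrt ((4 : ℕ) - 1 : ℝ) ≤ 1.4423 := (cbrt_le_iff (by norm_num) (by norm_num)).2
      (by norm_num)
    have hr0 : 0 ≤ cbrt ((4 : ℕ) - 1 : ℝ) := cbrt_nonneg (by norm_num)
    have hR : 1.587 ≤ cbrt ((4 : ℕ) : ℝ) := (le_cbrt_iff (by norm_num) (by norm_num)).2
      (by norm_num)
    have hq : 1.3862 ≤ Real.log ((4 : ℕ) : ℝ) := by
      push_cast
      linarith [log_four_gt]
    have h1 := aux _ _ _ _ _ (((4 : ℕ) - 1 : ℝ) / (4 : ℕ)) (by norm_num) hs.1 hs.2 hr0 hr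
      (by norm_num)
    have h2 : (4 : ℝ) * 1.3862 * 1.587 ≤ 4 * Real.log ((4 : ℕ) : ℝ) * cbrt ((4 : ℕ) : ℝ) := by
      gcongr
    norm_num at h1 h2 ⊢
    linarith
  · have hs : 1.5174 ≤ sqrtLogPairs 5 ∧ sqrtLogPairs 5 ≤ 1.5175 := by
      have h0 : Real.log 10 = Real.log 2 + Real.log 5 := by
        rw [← Real.log_mul (by norm_num) (by norm_num)]
        norm_num
      have h1 := Real.log_two_gt_d9
      have h2 := Real.log_two_lt_d9
      have h3 := Real.log_five_gt_d9
      have h4 := Real.log_five_lt_d9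
      apply sqrt_mem_Icc <;> norm_num [h0] at h1 h2 h3 h4 ⊢ <;> linarith
    have hr : cbrt ((5 : ℕ) - 1 : ℝ) ≤ 1.5875 := (cbrt_le_iff (by norm_num) (by norm_num)).2
      (by norm_num)
    have hr0 : 0 ≤ cbrt ((5 : ℕ) - 1 : ℝ) := cbrt_nonneg (by norm_num)
    have hR : 1.7 ≤ cbrt ((5 : ℕ) : ℝ) := (le_cbrt_iff (by norm_num) (by norm_num)).2
      (by norm_num)
    have hq : 1.609 ≤ Real.log ((5 : ℕ) : ℝ) := by
      push_cast
      linarith [Real.log_five_gt_d9]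
    have h1 := aux _ _ _ _ _ (((5 : ℕ) - 1 : ℝ) / (5 : ℕ)) (by norm_num) hs.1 hs.2 hr0 hr
      (by norm_num)
    have h2 : (4 : ℝ) * 1.609 * 1.7 ≤ 4 * Real.log ((5 : ℕ) : ℝ) * cbrt ((5 : ℕ) : ℝ) := by
      gcongr
    norm_num at h1 h2 ⊢
    linarith
  · have hK' : (6 : ℝ) ≤ K := by exact_mod_cast h6
    have hq : 1.7917 ≤ Real.log K := log_six_gt.le.trans (Real.log_le_log (by norm_num) hK')
    have hs2 := sqrtLogPairs_sq_le hK
    have hslo : 1.6455 ≤ sqrtLogPairs K := by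
      refine Real.le_sqrt_of_sq_le ?_
      have h1 : Real.log 15 ≤ Real.log (K * (K - 1) / 2) :=
        Real.log_le_log (by norm_num) (by nlinarith)
      rw [show (15 : ℝ) = 3 * 5 by norm_num, Real.log_mul (by norm_num) (by norm_num)] at h1
      have h2 := Real.log_three_gt_d9
      have h3 := Real.log_five_gt_d9
      norm_num at h2 h3 ⊢
      linarith
    set s := sqrtLogPairs K with hs
    have hr0 : 0 ≤ cbrt ((K : ℝ) - 1) := cbrt_nonneg (by linarith)
    have hrR : cbrt ((K : ℝ) - 1) ≤ cbrt K := cbrt_mono (by linarith) (by linarith)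
    have hf : 0.736 * (((K : ℝ) - 1) / K) / s ≤ 0.4474 := by
      have : ((K : ℝ) - 1) / K ≤ 1 := by
        rw [div_le_one (by linarith)]
        linarith
      rw [div_le_iff₀ (by linarith)]
      nlinarith
    have hlog2 := Real.log_two_gt_d9
    have h7 : 1.6557 + 1.3463 * (2 * s + 0.736 * (((K : ℝ) - 1) / K) / s) ≤ 4 * Real.log K := by
      nlinarith [sq_nonneg (s - 1.65)]
    have h8 : 4 * Real.log K * cbrt ((K : ℝ) - 1) ≤ 4 * Real.log K * cbrt K := by gcongr
    nlinarith

theorem gap_le_of_mem_modelClass {K : ℕ} {σ B : ℝ} {ν : Model K} (hν : ν ∈ modelClass K σ B)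
    (a : Fin K) : gap ν a ≤ B := by
  have : Nonempty (Fin K) := ⟨a⟩
  have h1 : (⨆ b, mean ν b) ≤ B := ciSup_le fun b => (hν b).2.2
  have h2 := (hν a).2.1
  unfold gap
  linarith

theorem exists_gap_eq_zero {K : ℕ} (hK : 2 ≤ K) (ν : Model K) : ∃ b, gap ν b = 0 := by
  have : Nonempty (Fin K) := ⟨⟨0, by omega⟩⟩
  obtain ⟨b, hb⟩ := exists_eq_ciSup_of_finite (f := mean ν)
  exact ⟨b, by unfold gap; rw [hb, sub_self]⟩

theorem card_erase_cast {K : ℕ} (b : Fin K) :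
    ((Finset.univ.erase b).card : ℝ) = (K : ℝ) - 1 := by
  rw [Finset.card_erase_of_mem (Finset.mem_univ b), Finset.card_univ, Fintype.card_fin,
    Nat.cast_sub b.pos, Nat.cast_one]

theorem log_le_of_le {K M n : ℕ} (hK : 0 < K) {δ : ℝ} (hδ : 0 < δ) (hn : 1 ≤ n) (hnM : n ≤ M) :
    Real.log (K * n * δ⁻¹) ≤ Real.log (K * M * δ⁻¹) := by
  have : (0 : ℝ) < n := by exact_mod_cast hn
  have : (0 : ℝ) < K := by exact_mod_cast hK
  refine Real.log_le_log (by positivity) ?_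
  gcongr

/-- The factor 1/K cancels the union over arms and Bδ ≤ c does the rest. The summand c is the one
that turns K c into (K + 1) c. -/
theorem sum_badBound_le {K : ℕ} {B δ c σ : ℝ} (hB : 0 ≤ B) (hδ : 0 < δ)
    (hBδ : B * δ ≤ c) {N : ℝ} (hN : 0 ≤ N) (b : Fin K) (D : Fin K → ℝ) :
    ∑ p ∈ (Finset.univ.erase b) ×ˢ Finset.Icc 1 (⌊N⌋₊ + 1),
      B * (δ / (K * p.2) * Real.exp (-(p.2 * D p.1 ^ 2 / (4 * σ ^ 2)))) ≤ c * (1 + N / 2) := by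
  have hK : (0 : ℝ) < K := by exact_mod_cast b.pos
  have hc : 0 ≤ c := (mul_nonneg hB hδ.le).trans hBδ
  calc ∑ p ∈ (Finset.univ.erase b) ×ˢ Finset.Icc 1 (⌊N⌋₊ + 1),
      B * (δ / (K * p.2) * Real.exp (-(p.2 * D p.1 ^ 2 / (4 * σ ^ 2))))
      ≤ ∑ p ∈ (Finset.univ.erase b) ×ˢ Finset.Icc 1 (⌊N⌋₊ + 1), c / K * (p.2 : ℝ)⁻¹ := by
        refine Finset.sum_le_sum fun p hp => ?_
        have h1 : Real.exp (-(p.2 * D p.1 ^ 2 / (4 * σ ^ 2))) ≤ 1 :=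
          Real.exp_le_one_iff.2 (neg_nonpos.2 (by positivity))
        calc B * (δ / (K * p.2) * Real.exp (-(p.2 * D p.1 ^ 2 / (4 * σ ^ 2))))
            ≤ B * (δ / (K * p.2) * 1) := by gcongr
          _ = B * δ / K * (p.2 : ℝ)⁻¹ := by
            rw [mul_one, div_mul_eq_div_div, div_eq_mul_inv (δ / K)]
            ring
          _ ≤ c / K * (p.2 : ℝ)⁻¹ := by gcongr
    _ = ((K : ℝ) - 1) * (c / K * ∑ n ∈ Finset.Icc 1 (⌊N⌋₊ + 1), (n : ℝ)⁻¹) := by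
        rw [Finset.sum_product]
        dsimp only
        rw [Finset.sum_const, nsmul_eq_mul, card_erase_cast, ← Finset.mul_sum]
    _ ≤ K * (c / K * (1 + N / 2)) := by
        have := sum_Icc_inv_le hN
        have h0 : 0 ≤ ∑ n ∈ Finset.Icc 1 (⌊N⌋₊ + 1), (n : ℝ)⁻¹ :=
          Finset.sum_nonneg fun _ _ => by positivity
        gcongr
        linarith
    _ = c * (1 + N / 2) := by field_simp

/-- The gap-independent bound with a free threshold `θ` and a bound `φ` for the tails. -/
theorem dbcareRisk_le_of_tail {K : ℕ} (hK : 2 ≤ K) {σ B c : ℝ} (hσ : 0 < σ) (hB : 0 < B)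
    (hc : 0 < c) {ν : Model K} (hν : ν ∈ modelClass K σ B) {θ φ : ℝ} (hθ : 0 ≤ θ)
    (hφ : ∀ y, 0 ≤ y → max (y - θ) 0 * Real.exp (-y ^ 2 / 4) ≤ φ) :
    dbcareRisk σ B c ν ≤ ENNReal.ofReal ((K + 1) * c + cbrt (σ ^ 2 * c) *
      (0.5519 * (3 * cbrt ((K : ℝ) - 1) - 1) + 0.27595 +
        1.3463 * cbrt ((K : ℝ) - 1) * (θ + ((K : ℝ) - 1) ^ 2 * φ))) := by
  obtain ⟨b, hb⟩ := exists_gap_eq_zero hK ν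
  have hδ := conf_pos hK hσ hB hc
  have hN := Nstar_antitone hσ hc
  have hN0 : ∀ k, 2 ≤ k → 0 ≤ Nstar σ c k := fun k hk => (Nstar_pos hσ hc hk).le
  have hgB := gap_le_of_mem_modelClass hν
  have hK2 : (2 : ℝ) ≤ K := by exact_mod_cast hK
  set u := cbrt (σ ^ 2 * c) with hu
  have hu0 : 0 < u := cbrt_pos (by positivity)
  set r := cbrt ((K : ℝ) - 1) with hr
  have hr0 : 0 < r := cbrt_pos (by linarith)
  have hr1 : 1 ≤ r := (le_cbrt_iff (by linarith) zero_le_one).2 (by norm_num; linarith)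
  have hφ0 : 0 ≤ φ := le_trans (by positivity) (hφ 0 le_rfl)
  have hscale : ∀ k, 2 ≤ k → k ≤ K → scale σ c k ≤ 1.3463 * r * u := by
    intro k hk hkK
    refine (scale_le hσ hc hk).trans ?_
    have h1 : (2 : ℝ) ≤ k := by exact_mod_cast hk
    have h2 : (k : ℝ) ≤ K := by exact_mod_cast hkK
    have : cbrt ((k : ℝ) - 1) ≤ r := cbrt_mono (by linarith) (by linarith)
    gcongr
  have hsum := Nstar_two_add_sum_le hσ hc hK
  set W := Nstar σ c 2 + ∑ k ∈ Finset.Icc 2 K, Nstar σ c k with hW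
  have hW0 : 0 ≤ W := add_nonneg (hN0 2 le_rfl)
    (Finset.sum_nonneg fun k hk => hN0 k (Finset.mem_Icc.1 hk).1)
  have hpulls : ∀ ω : Fin K × ℕ → ℝ, c * (totalPulls (Nstar σ c) σ (conf K σ B c) ω : ℝ) ≤
      c * (K + W) := fun ω => mul_le_mul_of_nonneg_left
    (totalPulls_le hN hN0 (epochs_pos hK hN0)) hc.le
  have key := risk_le_of_forall hc.le hσ hδ hK hN hN0 (fun a => (hν a).1) hb hgB
    (x := fun k => θ * scale σ c k) (fun k => mul_nonneg hθ (scale_pos hσ c k).le)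
    (Λ := max (Real.log (K * (⌊Nstar σ c 2⌋₊ + 1 : ℕ) * (conf K σ B c)⁻¹)) 0) (le_max_right _ _)
    (fun n hn hnM => (log_le_of_le (by omega) hδ hn hnM).trans (le_max_left _ _))
    -- The cost is bounded surely, so passes are free and a failure of the widths costs only the
    -- regret B.
    (C₀ := c * (K + W) + θ * (1.3463 * r * u)) (Cp := 0) (Cb := B)
    (by positivity) le_rfl hB.le
    (by
      rintro ω - z (rfl | ⟨hz2, rfl⟩)
      · have h1 : 0 ≤ θ * (1.3463 * r * u) := by positivity
        linarith [hpulls ω]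
      · have h1 := mul_le_mul_of_nonneg_left (hscale _ hz2 (card_survivors_le _)) hθ
        linarith [hpulls ω])
    (by
      intro ω
      have h1 : 0 ≤ θ * (1.3463 * r * u) := by positivity
      linarith [hpulls ω])
  refine key.trans (ENNReal.ofReal_le_ofReal ?_)
  have hbad := sum_badBound_le (σ := σ) hB.le hδ (conf_mul_le hK hσ hB hc) (hN0 2 le_rfl) b (gap ν)
  -- Measured in units of the scale, all tails are values of one function, bounded by φ; there are
  -- (K-1)² pairs.
  have htail : ∑ p ∈ (Finset.univ.erase b) ×ˢ Finset.Icc 2 K,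
      max (gap ν p.1 - θ * scale σ c p.2) 0 *
        Real.exp (-((⌊Nstar σ c p.2⌋₊ + 1 : ℕ) * gap ν p.1 ^ 2 / (4 * σ ^ 2))) ≤
      ((K : ℝ) - 1) ^ 2 * (1.3463 * r * u * φ) := by
    calc _ ≤ ∑ p ∈ (Finset.univ.erase b) ×ˢ Finset.Icc 2 K, 1.3463 * r * u * φ := by
          refine Finset.sum_le_sum fun p hp => ?_
          rw [Finset.mem_product, Finset.mem_Icc] at hp
          have hs := scale_pos hσ c p.2
          rw [exp_scale hσ]
          have h1 : gap ν p.1 - θ * scale σ c p.2 =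
              scale σ c p.2 * (gap ν p.1 / scale σ c p.2 - θ) := by field_simp
          have h2 := hφ (gap ν p.1 / scale σ c p.2) (div_nonneg (gap_nonneg _ _) hs.le)
          rw [h1, ← mul_zero (scale σ c p.2), ← mul_max_of_nonneg _ _ hs.le, mul_assoc]
          exact mul_le_mul (hscale _ hp.2.1 hp.2.2) h2
            (mul_nonneg (le_max_right _ _) (Real.exp_nonneg _)) (by positivity)
      _ = _ := by
          rw [Finset.sum_const, nsmul_eq_mul, Finset.card_product, Nat.cast_mul, card_erase_cast,
            Nat.card_Icc, show K + 1 - 2 = K - 1 by omega, Nat.cast_sub (by omega), Nat.cast_one]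
          ring
  have hcN : c * Nstar σ c 2 ≤ 0.5519 * u := by
    have h1 := mul_Nstar_mul_cbrt_sq hσ hc (le_refl 2)
    have h2 : cbrt (((2 : ℕ) : ℝ) - 1) = 1 := by norm_num [cbrt]
    rw [h2] at h1
    have := mul_le_mul_of_nonneg_right three_div_two_exp_le hu0.le
    linarith
  have hcW : c * W ≤ 0.5519 * u * (3 * r - 1) := by
    refine hsum.trans ?_
    have := three_div_two_exp_le
    gcongr
    linarith
  simp only [zero_mul, Finset.sum_const_zero, zero_add]
  linarith

/-- The gap-independent risk bound. -/
theorem dbcareRisk_le {K : ℕ} (hK : 2 ≤ K) {σ B c : ℝ} (hσ : 0 < σ) (hB : 0 < B)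
    (hc : 0 < c) {ν : Model K} (hν : ν ∈ modelClass K σ B) :
    dbcareRisk σ B c ν ≤ ENNReal.ofReal
      (4 * Real.log K * (cbrt K * cbrt (σ ^ 2 * c)) + (K + 1) * c) := by
  have hu0 : 0 < cbrt (σ ^ 2 * c) := cbrt_pos (by positivity)
  rcases (by omega : K = 2 ∨ 3 ≤ K) with rfl | hK3
  -- For K = 2 there is a single pair and no union to beat: θ = 0.
  · refine (dbcareRisk_le_of_tail hK hσ hB hc hν le_rfl (φ := 1) fun y hy => ?_).trans
      (ENNReal.ofReal_le_ofReal ?_)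
    · rw [sub_zero, max_eq_left hy]
      exact mul_exp_neg_sq_le
    · have h1 : cbrt (((2 : ℕ) : ℝ) - 1) = 1 := by norm_num [cbrt]
      rw [h1]
      have h2 : 1.25 ≤ cbrt ((2 : ℕ) : ℝ) := (le_cbrt_iff (by norm_num) (by norm_num)).2
        (by norm_num)
      have h3 : 0.69 ≤ Real.log ((2 : ℕ) : ℝ) := by
        push_cast
        linarith [Real.log_two_gt_d9]
      have h4 : 4 * 0.69 * (1.25 * cbrt (σ ^ 2 * c)) ≤
        4 * Real.log ((2 : ℕ) : ℝ) * (cbrt ((2 : ℕ) : ℝ) * cbrt (σ ^ 2 * c)) := by gcongr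
      norm_num at h4 ⊢
      linarith
  · have hs := one_le_sqrtLogPairs hK3
    have hsq := sqrtLogPairs_sq hK3
    have hK' : (3 : ℝ) ≤ K := by exact_mod_cast hK3
    have hnum := cost_add_regret_le_log_mul_cbrt hK3
    set s := sqrtLogPairs K with hsdef
    -- θ = 2s makes exp(-θ²/4) = 2/(K(K-1)), which offsets the (K-1)² pairs.
    refine (dbcareRisk_le_of_tail hK hσ hB hc hν (θ := 2 * s) (by linarith)
      (fun y _ => max_sub_mul_exp_le (by linarith) y)).trans (ENNReal.ofReal_le_ofReal ?_)
    have h1 : Real.exp (-(2 * s) ^ 2 / 4) = 2 / (K * (K - 1)) := by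
      rw [show -(2 * s) ^ 2 / 4 = -s ^ 2 by ring, hsq, Real.exp_neg,
        Real.exp_log (by linarith [three_le_pairs hK3]), inv_div]
    have h2 : ((K : ℝ) - 1) ^ 2 * (2 * Real.exp (-(2 * s) ^ 2 / 4) / (Real.exp 1 * (2 * s))) ≤
        0.736 * (((K : ℝ) - 1) / K) / s := by
      rw [h1]
      have h3 : 2 / Real.exp 1 ≤ 0.736 := by
        rw [div_le_iff₀ (Real.exp_pos 1)]
        linarith [Real.exp_one_gt_d9]
      have h4 : (0 : ℝ) < K - 1 := by linarith
      calc ((K : ℝ) - 1) ^ 2 * (2 * (2 / (K * (K - 1))) / (Real.exp 1 * (2 * s)))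
          = 2 / Real.exp 1 * (((K : ℝ) - 1) / K) / s := by field_simp
        _ ≤ _ := by gcongr
    have hr0 : 0 ≤ cbrt ((K : ℝ) - 1) := cbrt_nonneg (by linarith)
    have h5 : 1.3463 * cbrt ((K : ℝ) - 1) * (2 * s + ((K : ℝ) - 1) ^ 2 *
        (2 * Real.exp (-(2 * s) ^ 2 / 4) / (Real.exp 1 * (2 * s)))) ≤
        1.3463 * cbrt ((K : ℝ) - 1) * (2 * s + 0.736 * (((K : ℝ) - 1) / K) / s) := by
      gcongr
    have h6 : 0.5519 * (3 * cbrt ((K : ℝ) - 1) - 1) + 0.27595 +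
        1.3463 * cbrt ((K : ℝ) - 1) * (2 * s + ((K : ℝ) - 1) ^ 2 *
        (2 * Real.exp (-(2 * s) ^ 2 / 4) / (Real.exp 1 * (2 * s)))) ≤
        4 * Real.log K * cbrt K := by
      linarith
    have := mul_le_mul_of_nonneg_left h6 hu0.le
    linarith

/-! ### The complexity-dependent bound -/

theorem exp_sub_one_mul_sum_exp_le (a : ℝ) (M : ℕ) :
    (Real.exp a - 1) * ∑ n ∈ Finset.Icc 1 M, Real.exp (-(a * n)) ≤ 1 := by
  have h : (Real.exp a - 1) * ∑ n ∈ Finset.Icc 1 M, Real.exp (-(a * n)) =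
      1 - Real.exp (-(a * M)) := by
    induction M with
    | zero => simp
    | succ M ih =>
      rw [Finset.sum_Icc_succ_top (by omega), mul_add, ih]
      have : Real.exp a * Real.exp (-(a * (M + 1 : ℕ))) = Real.exp (-(a * M)) := by
        rw [← Real.exp_add]
        congr 1
        push_cast
        ring
      linarith
  rw [h]
  linarith [Real.exp_pos (-(a * M))]

theorem sum_exp_neg_le {a : ℝ} (ha : 0 < a) (M : ℕ) :
    ∑ n ∈ Finset.Icc 1 M, Real.exp (-(a * n)) ≤ 1 / a := by
  have h1 := exp_sub_one_mul_sum_exp_le a M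
  have h2 := Real.add_one_le_exp a
  rw [le_div_iff₀ ha]
  have h3 : 0 ≤ ∑ n ∈ Finset.Icc 1 M, Real.exp (-(a * n)) :=
    Finset.sum_nonneg fun _ _ => Real.exp_nonneg _
  nlinarith

theorem sum_Icc_one_succ (f : ℕ → ℝ) (M : ℕ) :
    ∑ n ∈ Finset.Icc 1 (M + 1), f n = f 1 + ∑ n ∈ Finset.Icc 1 M, f (n + 1) := by
  induction M with
  | zero => simp
  | succ M ih =>
    rw [Finset.sum_Icc_succ_top (by omega), ih, Finset.sum_Icc_succ_top (b := M) (by omega)]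
    ring

/-- For t ≥ 1 the first term is at most 1, and the rest is the same sum with t - 1. For t ≤ 1
convexity gives e^{at} ≤ 1 + t(e^a - 1), and e^a - 1 times the geometric sum is at most 1. No
additive constant may be lost: the resulting bound must be proportional to Δ⁻². -/
theorem sum_min_one_exp_le {a : ℝ} (ha : 0 < a) (M : ℕ) {t : ℝ} (ht : 0 ≤ t) :
    ∑ n ∈ Finset.Icc 1 M, min 1 (Real.exp (-(a * (n - t)))) ≤ t + 1 / a := by
  induction M generalizing t with
  | zero => simpa using by positivity
  | succ M ih =>
    rcases le_total 1 t with h | h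
    · have h1 := ih (t := t - 1) (by linarith)
      rw [sum_Icc_one_succ]
      have h2 : ∀ n : ℕ, ((n + 1 : ℕ) : ℝ) - t = n - (t - 1) := fun n => by
        push_cast
        ring
      simp only [h2]
      refine (add_le_add (min_le_left _ _) h1).trans_eq ?_
      ring
    · calc ∑ n ∈ Finset.Icc 1 (M + 1), min 1 (Real.exp (-(a * (n - t))))
          ≤ ∑ n ∈ Finset.Icc 1 (M + 1), Real.exp (a * t) * Real.exp (-(a * n)) := by
            refine Finset.sum_le_sum fun n _ => (min_le_right _ _).trans_eq ?_
            rw [← Real.exp_add]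
            congr 1
            ring
        _ = Real.exp (a * t) * ∑ n ∈ Finset.Icc 1 (M + 1), Real.exp (-(a * n)) := by
            rw [Finset.mul_sum]
        _ ≤ t + 1 / a := by
            have h1 := exp_sub_one_mul_sum_exp_le a (M + 1)
            have h2 := Real.add_one_le_exp a
            have h3 : Real.exp (a * t) ≤ 1 + t * (Real.exp a - 1) := by
              have := convexOn_exp.2 (Set.mem_univ 0) (Set.mem_univ a) (sub_nonneg.2 h) ht
                (by ring)
              simp only [smul_eq_mul, mul_zero, zero_add, Real.exp_zero, mul_one] at this
              rw [mul_comm a t]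
              linarith
            set S := ∑ n ∈ Finset.Icc 1 (M + 1), Real.exp (-(a * n))
            have hS : S ≤ 1 / a := sum_exp_neg_le ha _
            have hS0 : 0 ≤ S := Finset.sum_nonneg fun _ _ => Real.exp_nonneg _
            calc Real.exp (a * t) * S ≤ (1 + t * (Real.exp a - 1)) * S := by gcongr
              _ = S + t * ((Real.exp a - 1) * S) := by ring
              _ ≤ 1 / a + t * 1 := by gcongr
              _ = _ := by ring

theorem sum_passBound_le {σ Λ Δ : ℝ} (hσ : 0 < σ) (hΛ : 0 ≤ Λ) (hΔ : 0 < Δ) (M : ℕ) :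
    ∑ n ∈ Finset.Icc 1 M, passBound σ Λ Δ n ≤
      4 * σ ^ 2 * (Λ / (7 / 10) + 1 / (3 / 10)) * (Δ ^ 2)⁻¹ := by
  have hv : 0 < Δ ^ 2 / (4 * σ ^ 2) := by positivity
  have h := sum_min_one_exp_le (a := 3 / 10 * (Δ ^ 2 / (4 * σ ^ 2))) (by positivity) M
    (t := Λ / (7 / 10) / (Δ ^ 2 / (4 * σ ^ 2))) (by positivity)
  refine (Finset.sum_le_sum fun n _ => ?_).trans (h.trans_eq ?_)
  · unfold passBound
    refine min_le_min le_rfl (Real.exp_le_exp.2 (le_of_eq ?_))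
    field_simp
  · field_simp

/-- The complexity-dependent bound with a free threshold `θ`, a bound `ψ` for the tails and a
bound `Λ` for the logarithms in the confidence widths. -/
theorem dbcareRisk_le_of_complexity {K : ℕ} (hK : 2 ≤ K) {σ B c : ℝ} (hσ : 0 < σ) (hB : 0 < B)
    (hc : 0 < c) {ν : Model K} (hν : ν ∈ modelClass K σ B) {b : Fin K} (hb : gap ν b = 0)
    (hgap : ∀ a, a ≠ b → 0 < gap ν a) {H : ℝ}
    (hH : ∑ a ∈ Finset.univ.erase b, (gap ν a ^ 2)⁻¹ ≤ H)
    (hKB : ((K : ℝ) - 1) * (σ ^ 2 * c) ≤ B ^ 3) {θ ψ Λ : ℝ} (hθ : 0 ≤ θ)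
    (hψ : ∀ y, 0 ≤ y → max (y - θ) 0 * y ^ 2 * Real.exp (-y ^ 2 / 4) ≤ ψ) (hΛ0 : 0 ≤ Λ)
    (hΛ : Real.log (K * (⌊Nstar σ c 2⌋₊ + 1 : ℕ) * (conf K σ B c)⁻¹) ≤ Λ) :
    dbcareRisk σ B c ν ≤ ENNReal.ofReal (K * c + σ ^ 2 * c * H *
      ((2 + 2.44 * θ) * (4 * (Λ / (7 / 10) + 1 / (3 / 10))) +
        1.22 * (K * ((K : ℝ) - 1)) * ψ + 5.32)) := by
  have hδ := conf_pos hK hσ hB hc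
  have hN := Nstar_antitone hσ hc
  have hN0 : ∀ k, 2 ≤ k → 0 ≤ Nstar σ c k := fun k hk => (Nstar_pos hσ hc hk).le
  have hgB := gap_le_of_mem_modelClass hν
  have hK2 : (2 : ℝ) ≤ K := by exact_mod_cast hK
  have hψ0 : 0 ≤ ψ := le_trans (by positivity) (hψ 0 le_rfl)
  have hH0 : 0 ≤ H := le_trans (Finset.sum_nonneg fun _ _ => by positivity) hH
  have hsum := Nstar_two_add_sum_le hσ hc hK
  set W := Nstar σ c 2 + ∑ k ∈ Finset.Icc 2 K, Nstar σ c k with hW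
  have hW0 : 0 ≤ W := add_nonneg (hN0 2 le_rfl)
    (Finset.sum_nonneg fun k hk => hN0 k (Finset.mem_Icc.1 hk).1)
  -- By `hKB` the gap-free cost is at most 3 · 0.5519 · B.
  have hBW : B + c * W ≤ 2.66 * B := by
    have h1 : cbrt ((K : ℝ) - 1) * cbrt (σ ^ 2 * c) ≤ B := by
      rw [← cbrt_mul (by linarith) (by positivity), cbrt_le_iff
        (mul_nonneg (by linarith) (by positivity)) hB.le]
      exact hKB
    have hu := cbrt_nonneg (show 0 ≤ σ ^ 2 * c by positivity)
    have hr := cbrt_nonneg (show 0 ≤ (K : ℝ) - 1 by linarith)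
    have he := three_div_two_exp_le
    have h2 : 3 / (2 * Real.exp 1) * cbrt (σ ^ 2 * c) * (3 * cbrt ((K : ℝ) - 1) - 1) ≤
        0.5519 * cbrt (σ ^ 2 * c) * (3 * cbrt ((K : ℝ) - 1)) := by
      calc 3 / (2 * Real.exp 1) * cbrt (σ ^ 2 * c) * (3 * cbrt ((K : ℝ) - 1) - 1)
          ≤ 3 / (2 * Real.exp 1) * cbrt (σ ^ 2 * c) * (3 * cbrt ((K : ℝ) - 1)) := by
            gcongr
            linarith
        _ ≤ _ := by gcongr
    nlinarith
  have key := risk_le_of_forall hc.le hσ hδ hK hN hN0 (fun a => (hν a).1) hb hgB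
    (x := fun k => θ * scale σ c k) (fun k => mul_nonneg hθ (scale_pos hσ c k).le)
    hΛ0 (fun n hn hnM => (log_le_of_le (by omega) hδ hn hnM).trans hΛ)
    -- Each pass pays 2c for pulls and 2.44 θ c towards the threshold, by `scale_le_mul`.
    (C₀ := K * c) (Cp := (2 + 2.44 * θ) * c) (Cb := B + c * W)
    (by positivity) (by positivity) (by positivity)
    (by
      intro ω hsurv z hz
      have hpos : 0 < epochs (Nstar σ c) σ (conf K σ B c) ω := epochs_pos hK hN0
      have hT : epochs (Nstar σ c) σ (conf K σ B c) ω ≤ ⌊Nstar σ c 2⌋₊ + 1 := epochs_le hN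
      have h1 := mul_le_mul_of_nonneg_left (totalPulls_le_passCount hT hpos hsurv) hc.le
      have h2 := epochs_mul_card_le_passCount hT hsurv
      have h3 : z ≤ 2.44 * θ * c *
          passCount σ (conf K σ B c) (⌊Nstar σ c 2⌋₊ + 1) b ω := by
        have h4 : 0 ≤ passCount σ (conf K σ B c) (⌊Nstar σ c 2⌋₊ + 1) b ω :=
          Finset.sum_nonneg fun _ _ => Set.indicator_nonneg (fun _ _ => zero_le_one) _
        rcases hz with rfl | ⟨hz2, rfl⟩
        · positivity
        · have h5 := mul_le_mul_of_nonneg_left (scale_le_mul hσ hc hz2) hθ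
          rw [← epochs_eq hN hN0 hz2 hpos] at h5
          have h6 := mul_le_mul_of_nonneg_left h2 (show 0 ≤ 2.44 * θ * c by positivity)
          linarith
      linarith)
    (by
      intro ω
      have h1 := mul_le_mul_of_nonneg_left (totalPulls_le (σ := σ) (δ := conf K σ B c) (ω := ω)
        hN hN0 (epochs_pos hK hN0)) hc.le
      linarith)
  refine key.trans (ENNReal.ofReal_le_ofReal ?_)
  have hpass : ∑ p ∈ (Finset.univ.erase b) ×ˢ Finset.Icc 1 (⌊Nstar σ c 2⌋₊ + 1),
      (2 + 2.44 * θ) * c * passBound σ Λ (gap ν p.1) p.2 ≤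
      (2 + 2.44 * θ) * c * (4 * σ ^ 2 * (Λ / (7 / 10) + 1 / (3 / 10)) * H) := by
    rw [← Finset.mul_sum, Finset.sum_product]
    refine mul_le_mul_of_nonneg_left ?_ (by positivity)
    calc _ ≤ ∑ a ∈ Finset.univ.erase b,
          4 * σ ^ 2 * (Λ / (7 / 10) + 1 / (3 / 10)) * (gap ν a ^ 2)⁻¹ :=
          Finset.sum_le_sum fun a ha =>
            sum_passBound_le hσ hΛ0 (hgap a (Finset.ne_of_mem_erase ha)) _
      _ ≤ _ := by
          rw [← Finset.mul_sum]
          gcongr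
  -- A factor Δ⁻² is extracted, leaving scale³ times the function bounded by ψ; scale³ is linear in
  -- k - 1, and these factors sum to K(K-1)/2.
  have htail : ∑ p ∈ (Finset.univ.erase b) ×ˢ Finset.Icc 2 K,
      max (gap ν p.1 - θ * scale σ c p.2) 0 *
        Real.exp (-((⌊Nstar σ c p.2⌋₊ + 1 : ℕ) * gap ν p.1 ^ 2 / (4 * σ ^ 2))) ≤
      H * (2.44 * (σ ^ 2 * c) * ψ * (K * ((K : ℝ) - 1) / 2)) := by
    have hk : ∑ k ∈ Finset.Icc 2 K, ((k : ℝ) - 1) = K * ((K : ℝ) - 1) / 2 := by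
      clear * - hK
      induction K, hK using Nat.le_induction with
      | base => norm_num
      | succ n hn ih =>
        rw [Finset.sum_Icc_succ_top (by omega), ih]
        push_cast
        ring
    calc _ ≤ ∑ p ∈ (Finset.univ.erase b) ×ˢ Finset.Icc 2 K,
          (gap ν p.1 ^ 2)⁻¹ * (2.44 * (σ ^ 2 * c) * ψ * ((p.2 : ℝ) - 1)) := by
          refine Finset.sum_le_sum fun p hp => ?_
          rw [Finset.mem_product, Finset.mem_Icc] at hp
          have hs := scale_pos hσ c p.2
          have hg := hgap p.1 (Finset.ne_of_mem_erase hp.1)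
          rw [exp_scale hσ, inv_mul_eq_div, le_div_iff₀ (by positivity)]
          have h2 := hψ (gap ν p.1 / scale σ c p.2) (div_nonneg hg.le hs.le)
          obtain ⟨y, hy⟩ : ∃ y, gap ν p.1 = scale σ c p.2 * y := ⟨gap ν p.1 / scale σ c p.2, by
            field_simp⟩
          rw [hy, mul_div_cancel_left₀ _ hs.ne'] at h2 ⊢
          have h1 : scale σ c p.2 * y - θ * scale σ c p.2 = scale σ c p.2 * (y - θ) := by ring
          have h3 : max (scale σ c p.2 * (y - θ)) 0 = scale σ c p.2 * max (y - θ) 0 := by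
            rw [mul_max_of_nonneg _ _ hs.le, mul_zero]
          rw [h1, h3]
          calc scale σ c p.2 * max (y - θ) 0 * Real.exp (-y ^ 2 / 4) * (scale σ c p.2 * y) ^ 2
              = scale σ c p.2 ^ 3 * (max (y - θ) 0 * y ^ 2 * Real.exp (-y ^ 2 / 4)) := by ring
            _ ≤ (2.44 * (σ ^ 2 * c) * ((p.2 : ℝ) - 1)) * ψ := by
                have h4 := scale_pow_three_le hσ hc hp.2.1
                refine mul_le_mul h4 h2 ?_ ((by positivity : 0 ≤ scale σ c p.2 ^ 3).trans h4)
                exact mul_nonneg (mul_nonneg (le_max_right _ _) (sq_nonneg _)) (Real.exp_nonneg _)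
            _ = _ := by ring
      _ = (∑ a ∈ Finset.univ.erase b, (gap ν a ^ 2)⁻¹) *
          (2.44 * (σ ^ 2 * c) * ψ * (K * ((K : ℝ) - 1) / 2)) := by
          rw [← hk, Finset.mul_sum, Finset.sum_mul_sum, ← Finset.sum_product']
      _ ≤ _ := by
          refine mul_le_mul_of_nonneg_right hH ?_
          have : 0 ≤ (K : ℝ) - 1 := by linarith
          positivity
  have hbad : ∑ p ∈ (Finset.univ.erase b) ×ˢ Finset.Icc 1 (⌊Nstar σ c 2⌋₊ + 1),
      (B + c * W) * (conf K σ B c / (K * p.2) *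
        Real.exp (-(p.2 * gap ν p.1 ^ 2 / (4 * σ ^ 2)))) ≤ σ ^ 2 * c * H * 5.32 := by
    calc _ ≤ ∑ p ∈ (Finset.univ.erase b) ×ˢ Finset.Icc 1 (⌊Nstar σ c 2⌋₊ + 1),
          1.33 * c * Real.exp (-(gap ν p.1 ^ 2 / (4 * σ ^ 2) * p.2)) := by
          refine Finset.sum_le_sum fun p hp => ?_
          rw [Finset.mem_product, Finset.mem_Icc] at hp
          have hp1 : (1 : ℝ) ≤ p.2 := by exact_mod_cast hp.2.1
          -- K n ≥ 2 halves 2.66 to 1.33, and 4 · 1.33 = 5.32.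
          have h1 : conf K σ B c / (K * p.2) ≤ conf K σ B c / 2 := by
            gcongr
            nlinarith
          have h2 : (p.2 : ℝ) * gap ν p.1 ^ 2 / (4 * σ ^ 2) =
            gap ν p.1 ^ 2 / (4 * σ ^ 2) * p.2 := by ring
          have h3 := conf_mul_le hK hσ hB hc
          rw [h2, ← mul_assoc]
          refine mul_le_mul_of_nonneg_right ?_ (Real.exp_nonneg _)
          calc (B + c * W) * (conf K σ B c / (K * p.2))
              ≤ 2.66 * B * (conf K σ B c / 2) := by gcongr
            _ = 1.33 * (B * conf K σ B c) := by ring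
            _ ≤ 1.33 * c := by gcongr
      _ ≤ 1.33 * c * ∑ a ∈ Finset.univ.erase b, 4 * σ ^ 2 * (gap ν a ^ 2)⁻¹ := by
          rw [← Finset.mul_sum, Finset.sum_product]
          refine mul_le_mul_of_nonneg_left (Finset.sum_le_sum fun a ha => ?_) (by positivity)
          have hg := hgap a (Finset.ne_of_mem_erase ha)
          refine (sum_exp_neg_le (a := gap ν a ^ 2 / (4 * σ ^ 2)) (by positivity) _).trans_eq ?_
          field_simp
      _ ≤ 1.33 * c * (4 * σ ^ 2 * H) := by
          rw [← Finset.mul_sum]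
          gcongr
      _ = _ := by ring
  linarith

/-- The argument `K log K B σ^{4/3} / c^{5/3}` of the logarithm in the complexity-dependent
bound. -/
noncomputable def logArg (K : ℕ) (σ B c : ℝ) : ℝ :=
  K * Real.log K * B * σ ^ (4 / 3 : ℝ) / c ^ (5 / 3 : ℝ)

theorem logArg_pow_three {K : ℕ} {σ B c : ℝ} (hσ : 0 < σ) (hc : 0 < c) :
    logArg K σ B c ^ 3 = (K * Real.log K) ^ 3 * B ^ 3 * σ ^ 4 / c ^ 5 := by
  have h1 : (σ ^ (4 / 3 : ℝ)) ^ 3 = σ ^ 4 := by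
    rw [← Real.rpow_natCast, ← Real.rpow_mul hσ.le]
    norm_num
  have h2 : (c ^ (5 / 3 : ℝ)) ^ 3 = c ^ 5 := by
    rw [← Real.rpow_natCast, ← Real.rpow_mul hc.le]
    norm_num
  unfold logArg
  rw [div_pow, mul_pow, mul_pow, h1, h2]

theorem log_three_le {K : ℕ} (hK : 3 ≤ K) : 1.0986 ≤ Real.log K := by
  have h1 : Real.log 3 ≤ Real.log K := Real.log_le_log (by norm_num) (by exact_mod_cast hK)
  linarith [Real.log_three_gt_d9]

/-- The logarithms in the confidence widths are at most `3 log L` if the budget allows more than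
one epoch. -/
theorem mul_inv_conf_le {K : ℕ} (hK : 2 ≤ K) {σ B c : ℝ} (hσ : 0 < σ) (hB : 1 ≤ B)
    (hc : 0 < c) (hN : 1 ≤ Nstar σ c 2) {κ : ℝ} (hκ0 : 0 ≤ κ)
    (hκ : κ * (2 * (1 + 2.7183 * (cbrt K * Real.log K))) ≤ 35.4 * K ^ 2 * Real.log K ^ 3) :
    κ * (K * (⌊Nstar σ c 2⌋₊ + 1 : ℕ) * (conf K σ B c)⁻¹) ≤ logArg K σ B c ^ 3 := by
  have hK2 : (2 : ℝ) ≤ K := by exact_mod_cast hK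
  have hq : 0 < Real.log K := Real.log_pos (by linarith)
  have hN3 := Nstar_pow_three hσ hc (le_refl 2)
  set n := Nstar σ c 2 with hn
  have hfl : ((⌊n⌋₊ + 1 : ℕ) : ℝ) ≤ 2 * n := by
    have := Nat.floor_le (show 0 ≤ n by linarith)
    push_cast
    linarith
  have he := Real.exp_one_lt_d9
  have he' := Real.exp_one_gt_d9
  have hr : 0 ≤ cbrt (K : ℝ) := cbrt_nonneg (by linarith)
  have hconf : (conf K σ B c)⁻¹ ≤ B * n * (1 + 2.7183 * (cbrt K * Real.log K)) / c := by
    unfold conf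
    rw [mul_inv, inv_inv, ← hn, inv_mul_eq_div]
    change (B + Real.exp 1 * cbrt K * Real.log K * n) / c ≤ _
    gcongr
    have h1 : B * 1 ≤ B * n := by gcongr
    have h2 : Real.exp 1 * (cbrt K * Real.log K) * n ≤
      2.7183 * (cbrt K * Real.log K) * (B * n) := by
      have : (1 : ℝ) * n ≤ B * n := by gcongr
      have : n ≤ B * n := by linarith
      gcongr
      linarith
    linarith
  -- 35.4 ≤ 5.95² ≤ (2e/3)⁶, from the square of `Nstar_pow_three`.
  have hσ4 : 35.4 * n ^ 6 * c ^ 4 ≤ σ ^ 4 := by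
    have h1 : (2 * Real.exp 1 / 3) ^ 3 * (n ^ 3 * c ^ 2) = σ ^ 2 := by
      have h2 : (2 * Real.exp 1 / 3) ^ 3 * (3 / (2 * Real.exp 1)) ^ 3 = 1 := by
        rw [← mul_pow]
        have : 2 * Real.exp 1 / 3 * (3 / (2 * Real.exp 1)) = 1 := by field_simp
        rw [this, one_pow]
      have h3 : n ^ 3 * c ^ 2 = (3 / (2 * Real.exp 1)) ^ 3 * σ ^ 2 := by
        rw [← hN3]
        push_cast
        ring
      rw [h3, ← mul_assoc, h2, one_mul]
    have h4 : (5.95 : ℝ) ≤ (2 * Real.exp 1 / 3) ^ 3 := by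
      have : (1.8121 : ℝ) ≤ 2 * Real.exp 1 / 3 := by linarith
      calc (5.95 : ℝ) ≤ 1.8121 ^ 3 := by norm_num
        _ ≤ _ := by gcongr
    calc 35.4 * n ^ 6 * c ^ 4 ≤ (5.95 * (n ^ 3 * c ^ 2)) ^ 2 := by
          have : 0 ≤ n ^ 6 * c ^ 4 := by positivity
          nlinarith
      _ ≤ ((2 * Real.exp 1 / 3) ^ 3 * (n ^ 3 * c ^ 2)) ^ 2 := by gcongr
      _ = σ ^ 4 := by rw [h1]; ring
  rw [logArg_pow_three hσ hc, le_div_iff₀ (by positivity)]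
  calc κ * (K * (⌊n⌋₊ + 1 : ℕ) * (conf K σ B c)⁻¹) * c ^ 5
      ≤ κ * (K * (2 * n) * (B * n * (1 + 2.7183 * (cbrt K * Real.log K)) / c)) * c ^ 5 := by
        have : 0 ≤ (conf K σ B c)⁻¹ :=
          inv_nonneg.2 (conf_pos hK hσ (by linarith) hc).le
        gcongr
    _ = κ * (2 * (1 + 2.7183 * (cbrt K * Real.log K))) * (K * B * n ^ 2 * c ^ 4) := by
        field_simp
    _ ≤ 35.4 * K ^ 2 * Real.log K ^ 3 * (K * B * n ^ 2 * c ^ 4) := by gcongr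
    -- Here B ≥ 1 and N*(2) ≥ 1 raise the powers to those occurring in L³.
    _ ≤ 35.4 * K ^ 2 * Real.log K ^ 3 * (K * B ^ 3 * n ^ 6 * c ^ 4) := by
        have h1 : B ≤ B ^ 3 := le_self_pow₀ hB three_ne_zero
        have h2 : n ^ 2 ≤ n ^ 6 := pow_le_pow_right₀ hN (by norm_num)
        gcongr
    _ = (K * Real.log K) ^ 3 * B ^ 3 * (35.4 * n ^ 6 * c ^ 4) := by ring
    _ ≤ (K * Real.log K) ^ 3 * B ^ 3 * σ ^ 4 := by gcongr

/-- N*(2) ≥ 1 forces c ≤ σ, so c³ ≤ σ²c ≤ B³. It serves to show δ ≤ 1. -/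
theorem le_of_pow_three_le {σ B c : ℝ} {K : ℕ} (hK : 2 ≤ K) (hσ : 0 < σ) (hB : 0 < B)
    (hc : 0 < c) (hN : 1 ≤ Nstar σ c 2) (hKB : ((K : ℝ) - 1) * (σ ^ 2 * c) ≤ B ^ 3) : c ≤ B := by
  have hK2 : (2 : ℝ) ≤ K := by exact_mod_cast hK
  have hN3 := Nstar_pow_three hσ hc (le_refl 2)
  have he := Real.exp_one_gt_d9
  have h1 : 1 ≤ Nstar σ c 2 ^ 3 := one_le_pow₀ hN
  have h2 : (3 / (2 * Real.exp 1)) ^ 3 ≤ 1 := by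
    refine pow_le_one₀ (by positivity) ?_
    rw [div_le_one (by positivity)]
    linarith
  have h3 : c ^ 2 ≤ σ ^ 2 := by
    calc c ^ 2 = 1 * c ^ 2 := by ring
      _ ≤ Nstar σ c 2 ^ 3 * c ^ 2 := by gcongr
      _ = (3 / (2 * Real.exp 1)) ^ 3 * σ ^ 2 := by
        rw [← hN3]
        push_cast
        ring
      _ ≤ 1 * σ ^ 2 := by gcongr
      _ = σ ^ 2 := one_mul _
  refine le_of_pow_le_pow_left₀ three_ne_zero hB.le ?_
  have h4 : c ^ 2 * c ≤ σ ^ 2 * c := by gcongr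
  have h5 : 0 ≤ σ ^ 2 * c := by positivity
  nlinarith

/-- The choice of s cancels K(K-1) in the tail term, leaving a multiple of s. The -3 next to 3l
makes the constant part negative, enough to absorb that term and 5.32; the coefficient of l is
handled by 2s ≤ s² + 1 ≤ 2 log K - log 2 + 1. -/
theorem complexity_constant_le {K : ℕ} (hK3 : 3 ≤ K) {l : ℝ} (hl : 1 ≤ l) :
    (2 + 2.44 * (2 * sqrtLogPairs K)) * (4 * ((3 * l - 3) / (7 / 10) + 1 / (3 / 10))) +
      1.22 * (K * ((K : ℝ) - 1)) * (4 * (2 * sqrtLogPairs K) *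
        Real.exp (-(2 * sqrtLogPairs K) ^ 2 / 4) / Real.exp 1) + 5.32 ≤
      137.5 * Real.log K * l := by
  have hs := one_le_sqrtLogPairs hK3
  have hsq := sqrtLogPairs_sq hK3
  have hsq2 := sqrtLogPairs_sq_le hK3
  have hq := log_three_le hK3
  have hK3' : (3 : ℝ) ≤ K := by exact_mod_cast hK3
  set s := sqrtLogPairs K with hsdef
  have h1 : Real.exp (-(2 * s) ^ 2 / 4) = 2 / (K * (K - 1)) := by
    rw [show -(2 * s) ^ 2 / 4 = -s ^ 2 by ring, hsq, Real.exp_neg,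
      Real.exp_log (by linarith [three_le_pairs hK3]), inv_div]
  have h4 : 1.22 * (K * ((K : ℝ) - 1)) *
      (4 * (2 * s) * Real.exp (-(2 * s) ^ 2 / 4) / Real.exp 1) ≤ 7.19 * s := by
    have h5 : (0 : ℝ) < K - 1 := by linarith
    rw [h1]
    have h6 : 19.52 / Real.exp 1 ≤ 7.19 := by
      rw [div_le_iff₀ (Real.exp_pos 1)]
      linarith [Real.exp_one_gt_d9]
    calc 1.22 * (K * ((K : ℝ) - 1)) * (4 * (2 * s) * (2 / (K * (K - 1))) / Real.exp 1)
        = 19.52 / Real.exp 1 * s := by field_simp; norm_num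
      _ ≤ 7.19 * s := by gcongr
  have hs2 : 2 * s ≤ 2 * Real.log K - 0.693 + 1 := by
    nlinarith [sq_nonneg (s - 1), Real.log_two_gt_d9]
  have h8 : (2 + 4.88 * s) * 17.15 ≤ 137.5 * Real.log K := by linarith
  have h9 := mul_le_mul_of_nonneg_right h8 (show 0 ≤ l by linarith)
  have h10 : 0 ≤ s * l := by positivity
  linarith

theorem dbcareRisk_le_of_one_le_budget {K : ℕ} (hK : 2 ≤ K) {σ B c : ℝ} (hσ : 0 < σ)
    (hB : 1 ≤ B) (hc : 0 < c) (hN : 1 ≤ Nstar σ c 2) {ν : Model K} (hν : ν ∈ modelClass K σ B)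
    {b : Fin K} (hb : gap ν b = 0) (hgap : ∀ a, a ≠ b → 0 < gap ν a) {H : ℝ}
    (hH : ∑ a ∈ Finset.univ.erase b, (gap ν a ^ 2)⁻¹ ≤ H)
    (hKB : ((K : ℝ) - 1) * (σ ^ 2 * c) ≤ B ^ 3) (hL : 1 ≤ logArg K σ B c) :
    dbcareRisk σ B c ν ≤ ENNReal.ofReal
      (137.5 * Real.log K * Real.log (logArg K σ B c) * (σ ^ 2 * c * H) + (K + 1) * c) := by
  have hB0 : 0 < B := by linarith
  have hH0 : 0 ≤ H := le_trans (Finset.sum_nonneg fun _ _ => by positivity) hH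
  have hcB := le_of_pow_three_le hK hσ hB0 hc hN hKB
  have hK2 : (2 : ℝ) ≤ K := by exact_mod_cast hK
  have hδ := conf_pos hK hσ hB0 hc
  have hconf : 1 ≤ (conf K σ B c)⁻¹ := by
    rw [one_le_inv₀ hδ]
    have := conf_mul_le hK hσ hB0 hc
    nlinarith
  set X := (K : ℝ) * (⌊Nstar σ c 2⌋₊ + 1 : ℕ) * (conf K σ B c)⁻¹ with hX
  have hX4 : 4 ≤ X := by
    have h1 : 1 ≤ ⌊Nstar σ c 2⌋₊ := Nat.le_floor (by simpa using hN)
    have h2 : (2 : ℝ) ≤ (⌊Nstar σ c 2⌋₊ + 1 : ℕ) := by exact_mod_cast Nat.succ_le_succ h1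
    calc (4 : ℝ) = 2 * 2 * 1 := by norm_num
      _ ≤ X := by rw [hX]; gcongr
  have hX0 : 0 < X := by linarith
  have hG : 0 ≤ σ ^ 2 * c * H := by positivity
  have hlog : ∀ κ : ℝ, 0 < κ → κ * X ≤ logArg K σ B c ^ 3 →
      Real.log κ + Real.log X ≤ 3 * Real.log (logArg K σ B c) := by
    intro κ hκ h
    rw [← Real.log_mul hκ.ne' hX0.ne']
    refine (Real.log_le_log (by positivity) h).trans_eq ?_
    rw [Real.log_pow]
    norm_num
  set l := Real.log (logArg K σ B c) with hl
  rcases (by omega : K = 2 ∨ 3 ≤ K) with rfl | hK3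
  · have h2lo := Real.log_two_gt_d9
    have h2hi := Real.log_two_lt_d9
    -- κ = 4 together with X ≥ 4 gives 3l ≥ 2 log 4, so l is large enough to absorb the constants.
    have hκ := mul_inv_conf_le hK hσ hB hc hN (κ := 4) (by norm_num) (by
      have h1 : cbrt ((2 : ℕ) : ℝ) ≤ 1.26 := (cbrt_le_iff (by norm_num) (by norm_num)).2
        (by norm_num)
      have h3 : cbrt ((2 : ℕ) : ℝ) * Real.log ((2 : ℕ) : ℝ) ≤ 1.26 * 0.6932 := by
        push_cast at h1 ⊢
        have : Real.log 2 ≤ 0.6932 := by linarith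
        gcongr
      have h4 : (0.693 : ℝ) ^ 3 ≤ Real.log ((2 : ℕ) : ℝ) ^ 3 := by
        push_cast
        have : 0.693 ≤ Real.log 2 := by linarith
        gcongr
      push_cast at h3 h4 ⊢
      nlinarith)
    have h3 := hlog 4 (by norm_num) hκ
    have hlX : Real.log 4 ≤ Real.log X := Real.log_le_log (by norm_num) hX4
    have hl4 := log_four_gt
    refine (dbcareRisk_le_of_complexity hK hσ hB0 hc hν hb hgap hH hKB le_rfl (ψ := 4)
      (Λ := 3 * l) (fun y hy => ?_) (by linarith)
      (show Real.log X ≤ 3 * l by linarith)).trans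
      (ENNReal.ofReal_le_ofReal ?_)
    · rw [sub_zero, max_eq_left hy]
      calc y * y ^ 2 * Real.exp (-y ^ 2 / 4) = y ^ 3 * Real.exp (-y ^ 2 / 4) := by ring
        _ ≤ 4 := pow_three_mul_exp_le y
    · have h5 : (2 + 2.44 * 0) * (4 * (3 * l / (7 / 10) + 1 / (3 / 10))) +
          1.22 * (((2 : ℕ) : ℝ) * (((2 : ℕ) : ℝ) - 1)) * 4 + 5.32 ≤
          137.5 * Real.log ((2 : ℕ) : ℝ) * l := by
        push_cast
        have : 0 ≤ (Real.log 2 - 0.693) * l := mul_nonneg (by linarith) (by linarith)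
        linarith
      have := mul_le_mul_of_nonneg_left h5 hG
      linarith
  · have hs := one_le_sqrtLogPairs hK3
    have hsq := sqrtLogPairs_sq hK3
    have hsq2 := sqrtLogPairs_sq_le hK3
    have hq := log_three_le hK3
    have hK3' : (3 : ℝ) ≤ K := by exact_mod_cast hK3
    -- 20.1 exceeds e³, which yields log X ≤ 3l - 3 and hence l ≥ 1.
    have hκ := mul_inv_conf_le hK hσ hB hc hN (κ := 20.1) (by norm_num) (by
      have h1 : cbrt (K : ℝ) ≤ K / 2 := (cbrt_le_iff (by linarith) (by linarith)).2 (by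
        have : (0 : ℝ) ≤ K * (K ^ 2 - 9) := by nlinarith
        nlinarith)
      have h3 : cbrt (K : ℝ) * Real.log K ≤ K / 2 * Real.log K := by gcongr
      have h4 : 3.29 ≤ K * Real.log K := by nlinarith
      have h5 : 3 * 1.2 ≤ K * Real.log K ^ 2 := by nlinarith
      have h6 : 3.6 * (K * Real.log K) ≤ K * Real.log K ^ 2 * (K * Real.log K) := by gcongr; linarith
      nlinarith)
    have h3 := hlog 20.1 (by norm_num) hκ
    have hlX : 0 ≤ Real.log X := Real.log_nonneg (by linarith)
    have hl20 : 3 ≤ Real.log 20.1 := by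
      rw [Real.le_log_iff_exp_le (by norm_num), show (3 : ℝ) = (3 : ℕ) * 1 by norm_num,
        Real.exp_nat_mul]
      have := Real.exp_one_lt_d9
      calc Real.exp 1 ^ 3 ≤ 2.7182818286 ^ 3 := by gcongr
        _ ≤ 20.1 := by norm_num
    set s := sqrtLogPairs K with hsdef
    refine (dbcareRisk_le_of_complexity hK hσ hB0 hc hν hb hgap hH hKB (θ := 2 * s)
      (ψ := 4 * (2 * s) * Real.exp (-(2 * s) ^ 2 / 4) / Real.exp 1)
      (Λ := 3 * l - 3) (by linarith) (fun y _ => max_sub_mul_sq_mul_exp_le (by linarith))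
      (by linarith) (show Real.log X ≤ 3 * l - 3 by linarith)).trans
      (ENNReal.ofReal_le_ofReal ?_)
    have h7 := complexity_constant_le hK3 (show 1 ≤ l by linarith)
    have := mul_le_mul_of_nonneg_left h7 hG
    linarith

/-! ### The one-epoch regime N*(2) < 1 -/

theorem lt_mul_of_budget_lt_one {σ c : ℝ} (hσ : 0 < σ) (hc : 0 < c) (hN : Nstar σ c 2 < 1) :
    σ ≤ 2.44 * c := by
  have h := scale_le_mul hσ hc (le_refl 2)
  unfold scale at h
  rw [Nat.floor_eq_zero.2 hN] at h
  norm_num at h ⊢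
  exact h

/-- L⁹ contains B⁹σ¹²/c¹⁵, and B⁹ ≥ B³ ≥ σ²c. The result depends on σ/c only: a small log L forces a
small σ/c. -/
theorem pow_nine_mul_le {K : ℕ} {σ B c : ℝ} (hσ : 0 < σ) (hB : 1 ≤ B) (hc : 0 < c)
    (hσB : σ ^ 2 * c ≤ B ^ 3) :
    (K * Real.log K) ^ 9 * (σ / c) ^ 14 ≤ logArg K σ B c ^ 9 := by
  have h1 : σ ^ 2 * c ≤ B ^ 9 := hσB.trans (pow_le_pow_right₀ hB (by norm_num))
  rw [show logArg K σ B c ^ 9 = (logArg K σ B c ^ 3) ^ 3 by ring, logArg_pow_three hσ hc]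
  calc (K * Real.log K) ^ 9 * (σ / c) ^ 14
      = (K * Real.log K) ^ 9 * (σ ^ 2 * c) * σ ^ 12 / c ^ 15 := by field_simp
    _ ≤ (K * Real.log K) ^ 9 * B ^ 9 * σ ^ 12 / c ^ 15 := by gcongr
    _ = _ := by ring

theorem dbcareRisk_le_of_budget_lt_one {K : ℕ} (hK : 2 ≤ K) {σ B c : ℝ} (hσ : 0 < σ)
    (hB : 1 ≤ B) (hc : 0 < c) (hN : Nstar σ c 2 < 1) {ν : Model K} (hν : ν ∈ modelClass K σ B)
    {b : Fin K} (hb : gap ν b = 0) (hgap : ∀ a, a ≠ b → 0 < gap ν a) {H : ℝ}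
    (hH : ∑ a ∈ Finset.univ.erase b, (gap ν a ^ 2)⁻¹ ≤ H)
    (hσB : σ ^ 2 * c ≤ B ^ 3) (hL : 1 ≤ logArg K σ B c) :
    dbcareRisk σ B c ν ≤ ENNReal.ofReal
      (137.5 * Real.log K * Real.log (logArg K σ B c) * (σ ^ 2 * c * H) + (K + 1) * c) := by
  have hH0 : 0 ≤ H := le_trans (Finset.sum_nonneg fun _ _ => by positivity) hH
  have hK2 : (2 : ℝ) ≤ K := by exact_mod_cast hK
  have hq0 : 0 < Real.log K := Real.log_pos (by linarith)
  have hl0 : 0 ≤ Real.log (logArg K σ B c) := Real.log_nonneg hL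
  have hrisk : ∀ x, 0 ≤ x → dbcareRisk σ B c ν ≤ ENNReal.ofReal (c * K + x +
      ∑ a ∈ Finset.univ.erase b, max (gap ν a - x) 0 *
        Real.exp (-(gap ν a ^ 2 / (4 * σ ^ 2)))) := fun x hx =>
    risk_le_of_budget_lt_one hc.le hσ hK (Nstar_antitone hσ hc)
      (fun k hk => (Nstar_pos hσ hc hk).le) hN (fun a => (hν a).1) hb hx
  have hexp : ∀ D : ℝ, Real.exp (-(D ^ 2 / (4 * σ ^ 2))) = Real.exp (-(D / σ) ^ 2 / 4) := by
    intro D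
    congr 1
    field_simp
  have hG : 0 ≤ σ ^ 2 * c * H := by positivity
  -- If the coefficient is at least 9.76 = 4 · 2.44, it covers the regret, bounded with y³exp(-y²/4)
  -- ≤ 4 and σ ≤ 2.44 c.
  by_cases hbig : 9.76 ≤ 137.5 * Real.log K * Real.log (logArg K σ B c)
  · refine (hrisk 0 le_rfl).trans (ENNReal.ofReal_le_ofReal ?_)
    have h1 : ∑ a ∈ Finset.univ.erase b, max (gap ν a - 0) 0 *
        Real.exp (-(gap ν a ^ 2 / (4 * σ ^ 2))) ≤ 9.76 * (σ ^ 2 * c * H) := by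
      calc _ ≤ ∑ a ∈ Finset.univ.erase b, 4 * σ ^ 3 * (gap ν a ^ 2)⁻¹ := by
            refine Finset.sum_le_sum fun a ha => ?_
            have hg := hgap a (Finset.ne_of_mem_erase ha)
            rw [sub_zero, max_eq_left hg.le, hexp, ← div_eq_mul_inv, le_div_iff₀ (by positivity)]
            calc gap ν a * Real.exp (-(gap ν a / σ) ^ 2 / 4) * gap ν a ^ 2
                = ((gap ν a / σ) ^ 3 * Real.exp (-(gap ν a / σ) ^ 2 / 4)) * σ ^ 3 := by
                  field_simp
              _ ≤ 4 * σ ^ 3 := by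
                  gcongr
                  exact pow_three_mul_exp_le _
        _ ≤ 4 * σ ^ 3 * H := by
            rw [← Finset.mul_sum]
            gcongr
        _ = 4 * σ ^ 2 * H * σ := by ring
        _ ≤ 4 * σ ^ 2 * H * (2.44 * c) := by
            have := lt_mul_of_budget_lt_one hσ hc hN
            gcongr
        _ = _ := by ring
    have h2 := mul_le_mul_of_nonneg_right hbig hG
    linarith
  · push Not at hbig
    -- Otherwise log L is small, hence so is ρ = σ/c, and the whole regret fits into the spare c.
    suffices h : dbcareRisk σ B c ν ≤ ENNReal.ofReal ((K + 1) * c) by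
      refine h.trans (ENNReal.ofReal_le_ofReal ?_)
      have : 0 ≤ 137.5 * Real.log K * Real.log (logArg K σ B c) * (σ ^ 2 * c * H) := by positivity
      linarith
    have h9 := pow_nine_mul_le (K := K) hσ hB hc hσB
    obtain ⟨ρ, rfl⟩ : ∃ ρ, σ = ρ * c := ⟨σ / c, by field_simp⟩
    have hρ : 0 < ρ := pos_of_mul_pos_left hσ hc.le
    rw [mul_div_cancel_right₀ _ hc.ne'] at h9
    have hL9 : logArg K (ρ * c) B c ^ 9 = Real.exp (9 * Real.log (logArg K (ρ * c) B c)) := by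
      rw [show (9 : ℝ) = (9 : ℕ) by norm_num, Real.exp_nat_mul, Real.exp_log (by linarith)]
    rw [hL9] at h9
    set l := Real.log (logArg K (ρ * c) B c) with hl
    have hcard : ∀ z : ℝ, ∑ a ∈ Finset.univ.erase b, z = ((K : ℝ) - 1) * z := fun z => by
      rw [Finset.sum_const, nsmul_eq_mul, card_erase_cast]
    have hsmall : ((K : ℝ) - 1) * ρ ≤ 1 → dbcareRisk (ρ * c) B c ν ≤
        ENNReal.ofReal ((K + 1) * c) := by
      intro h
      refine (hrisk 0 le_rfl).trans (ENNReal.ofReal_le_ofReal ?_)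
      have h1 : ∑ a ∈ Finset.univ.erase b, max (gap ν a - 0) 0 *
          Real.exp (-(gap ν a ^ 2 / (4 * (ρ * c) ^ 2))) ≤ ((K : ℝ) - 1) * (ρ * c) := by
        rw [← hcard]
        refine Finset.sum_le_sum fun a ha => ?_
        rw [sub_zero, max_eq_left (gap_nonneg ν a), hexp]
        calc gap ν a * Real.exp (-(gap ν a / (ρ * c)) ^ 2 / 4)
            = (gap ν a / (ρ * c)) * Real.exp (-(gap ν a / (ρ * c)) ^ 2 / 4) * (ρ * c) := by
              field_simp
          _ ≤ 1 * (ρ * c) := by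
              gcongr
              exact mul_exp_neg_sq_le
          _ = _ := one_mul _
      nlinarith
    have hexp1 : ∀ x : ℝ, 0 ≤ x → x ≤ 1 → Real.exp x ≤ 1 + x + x ^ 2 := fun x h0 h1 => by
      have := Real.abs_exp_sub_one_sub_id_le (x := x) (by rwa [abs_of_nonneg h0])
      linarith [(abs_le.1 this).2]
    rcases (by omega : K = 2 ∨ K = 3 ∨ 4 ≤ K) with rfl | rfl | hK4
    · have hq : 0.693 ≤ Real.log ((2 : ℕ) : ℝ) := by
        push_cast
        linarith [Real.log_two_gt_d9]
      apply hsmall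
      by_contra! h
      have hρ1 : 1 ≤ ρ := by
        push_cast at h
        linarith
      have h1 : 9 * l ≤ 1 := by nlinarith
      have h2 := hexp1 (9 * l) (by positivity) h1
      have h3 : (((2 : ℕ) : ℝ) * 0.693) ^ 9 * 1 ^ 14 ≤
          (((2 : ℕ) : ℝ) * Real.log ((2 : ℕ) : ℝ)) ^ 9 * ρ ^ 14 := by gcongr
      norm_num at h3 h9
      nlinarith
    · have hq : 1.0986 ≤ Real.log ((3 : ℕ) : ℝ) := by
        push_cast
        linarith [Real.log_three_gt_d9]
      apply hsmall
      by_contra! h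
      have hρ1 : 1 / 2 ≤ ρ := by
        push_cast at h
        linarith
      have h1 : 9 * l ≤ 0.6 := by nlinarith
      have h2 := hexp1 (9 * l) (by positivity) (by linarith)
      have h3 : (((3 : ℕ) : ℝ) * 1.0986) ^ 9 * (1 / 2) ^ 14 ≤
          (((3 : ℕ) : ℝ) * Real.log ((3 : ℕ) : ℝ)) ^ 9 * ρ ^ 14 := by gcongr
      norm_num at h3 h9
      nlinarith
    · have hK4' : (4 : ℝ) ≤ K := by exact_mod_cast hK4
      have hq : 1.386 ≤ Real.log K := by
        have := Real.log_le_log (by norm_num) hK4'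
        linarith [log_four_gt]
      -- Squaring (K log K)⁹ρ¹⁴ ≤ 2 exposes the factor (Kρ⁴)⁷.
      have hρ4 : K * ρ ^ 4 ≤ 0.09 := by
        by_contra! h
        have h1 : 9 * l ≤ 0.5 := by nlinarith
        have h2 := hexp1 (9 * l) (by positivity) (by linarith)
        have h3 : Real.exp (9 * l) ≤ 2 := by nlinarith
        have h4 := h9.trans h3
        have h5 : ((K * Real.log K) ^ 9 * ρ ^ 14) ^ 2 ≤ 2 ^ 2 := by gcongr
        have h6 : (0.09 : ℝ) ^ 7 * (4 ^ 11 * 1.386 ^ 18) ≤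
            (K * ρ ^ 4) ^ 7 * ((K : ℝ) ^ 11 * Real.log K ^ 18) := by gcongr
        have h7 : (K * ρ ^ 4) ^ 7 * ((K : ℝ) ^ 11 * Real.log K ^ 18) =
            ((K * Real.log K) ^ 9 * ρ ^ 14) ^ 2 := by ring
        rw [h7] at h6
        norm_num at h5 h6
        linarith
      -- The spare c is split into a threshold 2c/3 and a tail of at most c/3. In the tail, e^{-t} ≤
      -- 1/(et) at t = 1/(9ρ²) gives the power ρ⁴.
      refine (hrisk (2 / 3 * c) (by positivity)).trans (ENNReal.ofReal_le_ofReal ?_)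
      have h1 : ∑ a ∈ Finset.univ.erase b, max (gap ν a - 2 / 3 * c) 0 *
          Real.exp (-(gap ν a ^ 2 / (4 * (ρ * c) ^ 2))) ≤
          ((K : ℝ) - 1) * (27 / Real.exp 1 ^ 2 * ρ ^ 4 * c) := by
        rw [← hcard]
        refine Finset.sum_le_sum fun a ha => ?_
        have h2 := max_sub_mul_exp_le (θ := 2 / 3 / ρ) (by positivity) (gap ν a / (ρ * c))
        have h3 : gap ν a - 2 / 3 * c = ρ * c * (gap ν a / (ρ * c) - 2 / 3 / ρ) := by field_simp
        have h4 : max (ρ * c * (gap ν a / (ρ * c) - 2 / 3 / ρ)) 0 =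
            ρ * c * max (gap ν a / (ρ * c) - 2 / 3 / ρ) 0 := by
          rw [mul_max_of_nonneg _ _ (by positivity), mul_zero]
        have h5 : Real.exp (-(2 / 3 / ρ) ^ 2 / 4) ≤ 9 * ρ ^ 2 / Real.exp 1 := by
          have h6 := mul_exp_neg_le (t := 1 / (9 * ρ ^ 2)) one_pos
          have h7 : -(2 / 3 / ρ) ^ 2 / 4 = -(1 * (1 / (9 * ρ ^ 2))) := by
            field_simp
            norm_num
          rw [h7]
          rw [one_div_mul_eq_div, div_le_iff₀ (by positivity)] at h6
          refine h6.trans_eq ?_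
          field_simp
        rw [hexp, h3, h4, mul_assoc]
        calc ρ * c * (max (gap ν a / (ρ * c) - 2 / 3 / ρ) 0 *
              Real.exp (-(gap ν a / (ρ * c)) ^ 2 / 4))
            ≤ ρ * c * (2 * (9 * ρ ^ 2 / Real.exp 1) / (Real.exp 1 * (2 / 3 / ρ))) := by
              refine mul_le_mul_of_nonneg_left (h2.trans ?_) (by positivity)
              gcongr
          _ = _ := by
              field_simp
              norm_num
      have h2 : 27 / Real.exp 1 ^ 2 ≤ 3.7 := by
        rw [div_le_iff₀ (by positivity)]
        have := Real.exp_one_gt_d9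
        nlinarith
      have h3 : ((K : ℝ) - 1) * (27 / Real.exp 1 ^ 2 * ρ ^ 4 * c) ≤ 1 / 3 * c := by
        calc ((K : ℝ) - 1) * (27 / Real.exp 1 ^ 2 * ρ ^ 4 * c)
            ≤ K * (3.7 * ρ ^ 4 * c) := by
              gcongr
              linarith
          _ = 3.7 * (K * ρ ^ 4) * c := by ring
          _ ≤ 3.7 * 0.09 * c := by gcongr
          _ ≤ 1 / 3 * c := by
              gcongr
              norm_num
      linarith

/-! ### The comparison quantities -/

/-- A finite complexity excludes a second zero gap, since its inverse square would be ∞. The sum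
over sorted gaps becomes a sum over arms by reindexing along the sorting permutation. -/
theorem exists_gap_of_mem_modelClassH {K : ℕ} (hK : 2 ≤ K) {σ B : ℝ} {H : ℝ≥0∞} {Δ₂ : ℝ}
    (hH : H ≠ ∞) {ν : Model K} (hν : ν ∈ modelClassH hK σ B H Δ₂) :
    ∃ b, gap ν b = 0 ∧ (∀ a, a ≠ b → 0 < gap ν a) ∧
      ∑ a ∈ Finset.univ.erase b, (gap ν a ^ 2)⁻¹ ≤ H.toReal := by
  obtain ⟨-, hcomp, -⟩ := hν
  set e := Tuple.sort (gap ν) with he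
  set z : Fin K := ⟨0, by omega⟩ with hz
  have hzero : gap ν (e z) = 0 := by
    obtain ⟨d, hd⟩ := exists_gap_eq_zero hK ν
    have h1 : gap ν (e z) ≤ gap ν (e (e.symm d)) :=
      Tuple.monotone_sort (gap ν) (Fin.le_def.2 (Nat.zero_le _))
    rw [Equiv.apply_symm_apply, hd] at h1
    exact le_antisymm h1 (gap_nonneg ν _)
  have hsum : complexity ν =
      ∑ a ∈ Finset.univ.erase (e z), (ENNReal.ofReal (gap ν a) ^ 2)⁻¹ := by
    unfold complexity
    refine Finset.sum_bij (fun i _ => e i) ?_ (fun i _ j _ h => e.injective h) ?_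
      (fun i _ => rfl)
    · intro i hi
      rw [Finset.mem_filter] at hi
      refine Finset.mem_erase.2 ⟨fun h => ?_, Finset.mem_univ _⟩
      rw [e.injective h] at hi
      exact lt_irrefl _ hi.2
    · intro a ha
      refine ⟨e.symm a, ?_, e.apply_symm_apply a⟩
      rw [Finset.mem_filter]
      refine ⟨Finset.mem_univ _, Nat.pos_of_ne_zero fun h => Finset.ne_of_mem_erase ha ?_⟩
      have : e.symm a = z := Fin.ext h
      rw [← this, e.apply_symm_apply]
  rw [hsum] at hcomp
  have hpos : ∀ a, a ≠ e z → 0 < gap ν a := by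
    intro a ha
    rcases (gap_nonneg ν a).lt_or_eq with h | h
    · exact h
    · have h1 := (Finset.single_le_sum (f := fun a => (ENNReal.ofReal (gap ν a) ^ 2)⁻¹)
        (fun _ _ => zero_le) (Finset.mem_erase.2 ⟨ha, Finset.mem_univ a⟩)).trans hcomp
      simp only [← h] at h1
      simp at h1
      exact absurd h1 hH
  refine ⟨e z, hzero, hpos, ?_⟩
  rw [← ENNReal.ofReal_le_iff_le_toReal hH, ENNReal.ofReal_sum_of_nonneg
    fun _ _ => by positivity]
  refine (Finset.sum_congr rfl fun a ha => ?_).trans_le hcomp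
  have hg := hpos a (Finset.ne_of_mem_erase ha)
  rw [ENNReal.ofReal_inv_of_pos (by positivity), ENNReal.ofReal_pow hg.le]

theorem dbcareRisk_le_of_mem_modelClassH {K : ℕ} (hK : 2 ≤ K) {σ B c : ℝ} (hσ : 0 < σ)
    (hB : 1 ≤ B) (hc : 0 < c) {H : ℝ≥0∞} {Δ₂ : ℝ} (hH : 0 < H)
    (hHΔ : H / ENNReal.ofReal Δ₂ ≤ ENNReal.ofReal (σ ^ 2 * c)⁻¹) (hL : 1 ≤ logArg K σ B c)
    {ν : Model K} (hν : ν ∈ modelClassH hK σ B H Δ₂) :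
    dbcareRisk σ B c ν ≤ ENNReal.ofReal
      (550 * Real.log K * Real.log (logArg K σ B c) * hardness σ c H Δ₂ + (K + 1) * c) := by
  have hK2 : (2 : ℝ) ≤ K := by exact_mod_cast hK
  have hq0 : 0 < Real.log K := Real.log_pos (by linarith)
  have hl0 : 0 ≤ Real.log (logArg K σ B c) := Real.log_nonneg hL
  -- For Δ₂ = 0 the quotient is ∞, because H > 0.
  have hΔpos : 0 < Δ₂ := by
    by_contra! h
    rw [ENNReal.ofReal_of_nonpos h, ENNReal.div_zero hH.ne'] at hHΔ
    exact absurd hHΔ (not_le.2 ENNReal.ofReal_lt_top)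
  have hHle : H ≤ ENNReal.ofReal ((σ ^ 2 * c)⁻¹ * Δ₂) := by
    rw [ENNReal.ofReal_mul (by positivity)]
    exact (ENNReal.div_le_iff (by simpa using hΔpos) ENNReal.ofReal_ne_top).1 hHΔ
  have hHtop : H ≠ ∞ := ne_top_of_le_ne_top ENNReal.ofReal_ne_top hHle
  obtain ⟨b, hb, hgap, hsum⟩ := exists_gap_of_mem_modelClassH hK hHtop hν
  set h := H.toReal with hh
  have hhpos : 0 < h := ENNReal.toReal_pos hH.ne' hHtop
  have hGΔ : σ ^ 2 * c * h ≤ Δ₂ := by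
    have h1 := ENNReal.toReal_le_of_le_ofReal (by positivity) hHle
    rw [inv_mul_eq_div, le_div_iff₀ (by positivity)] at h1
    linarith
  have hgB := gap_le_of_mem_modelClass hν.1
  have hΔB : Δ₂ ≤ B := by
    rw [← hν.2.2]
    exact hgB _
  -- All gaps are at most B, so (K-1)/B² ≤ H, while σ²cH ≤ Δ₂ ≤ B.
  have hKB : ((K : ℝ) - 1) * (σ ^ 2 * c) ≤ B ^ 3 := by
    have h1 : ((K : ℝ) - 1) * (B ^ 2)⁻¹ ≤ h := by
      refine le_trans ?_ hsum
      rw [← card_erase_cast b, ← nsmul_eq_mul, ← Finset.sum_const]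
      refine Finset.sum_le_sum fun a ha => ?_
      have h2 := hgap a (Finset.ne_of_mem_erase ha)
      have h3 := hgB a
      gcongr
    have h2 : (K : ℝ) - 1 ≤ h * B ^ 2 := by
      rwa [← div_eq_mul_inv, div_le_iff₀ (by positivity)] at h1
    calc ((K : ℝ) - 1) * (σ ^ 2 * c) ≤ h * B ^ 2 * (σ ^ 2 * c) := by gcongr
      _ = σ ^ 2 * c * h * B ^ 2 := by ring
      _ ≤ B * B ^ 2 := by
          gcongr
          linarith
      _ = B ^ 3 := by ring
  have hσB : σ ^ 2 * c ≤ B ^ 3 := by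
    have : 0 < σ ^ 2 * c := by positivity
    nlinarith
  have hmain : dbcareRisk σ B c ν ≤ ENNReal.ofReal
      (137.5 * Real.log K * Real.log (logArg K σ B c) * (σ ^ 2 * c * h) + (K + 1) * c) := by
    rcases lt_or_ge (Nstar σ c 2) 1 with hN | hN
    · exact dbcareRisk_le_of_budget_lt_one hK hσ hB hc hN hν.1 hb hgap hsum hσB hL
    · exact dbcareRisk_le_of_one_le_budget hK hσ hB hc hN hν.1 hb hgap hsum hKB hL
  refine hmain.trans (ENNReal.ofReal_le_ofReal ?_)
  -- The argument of the logarithm is at least e. The factor 4 turns 137.5 into 550.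
  have hhard : σ ^ 2 * c * h ≤ 4 * hardness σ c H Δ₂ := by
    unfold hardness
    rw [if_pos hHΔ, ← hh]
    have h1 : 1 ≤ Real.log (Real.exp 1 * Δ₂ / (σ ^ 2 * c * h)) := by
      rw [Real.le_log_iff_exp_le (by positivity), le_div_iff₀ (by positivity)]
      gcongr
    have h2 : c * σ ^ 2 * h / 4 * 1 ≤
      c * σ ^ 2 * h / 4 * Real.log (Real.exp 1 * Δ₂ / (σ ^ 2 * c * h)) := by gcongr
    linarith
  have := mul_le_mul_of_nonneg_left hhard
    (show 0 ≤ 137.5 * Real.log K * Real.log (logArg K σ B c) by positivity)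
  linarith

/-- Reduces to K e ≤ (15/8)³ (K - 1), true since K ≤ 2(K - 1) and 2e < (15/8)³. -/
theorem le_hardnessStar {K : ℕ} (hK : 2 ≤ K) {σ c : ℝ} (hσ : 0 < σ) (hc : 0 < c) :
    4 * (cbrt K * cbrt (σ ^ 2 * c)) ≤ 20 * hardnessStar K σ c := by
  have hK2 : (2 : ℝ) ≤ K := by exact_mod_cast hK
  have hK1 : (0 : ℝ) ≤ K - 1 := by linarith
  have he := Real.exp_one_lt_d9
  change _ ≤ 20 * (3 / 8 * cbrt (((K : ℝ) - 1) * σ ^ 2 * c / Real.exp 1))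
  rw [← cbrt_mul (by linarith) (by positivity)]
  have h0 : 0 ≤ ((K : ℝ) - 1) * σ ^ 2 * c / Real.exp 1 := by positivity
  have h1 : cbrt (K * (σ ^ 2 * c)) ≤
      15 / 8 * cbrt (((K : ℝ) - 1) * σ ^ 2 * c / Real.exp 1) := by
    rw [cbrt_le_iff (by positivity) (mul_nonneg (by norm_num) (cbrt_nonneg h0)), mul_pow,
      cbrt_pow_three h0, ← mul_div_assoc, le_div_iff₀ (Real.exp_pos 1)]
    have h2 : (K : ℝ) * Real.exp 1 ≤ (15 / 8) ^ 3 * ((K : ℝ) - 1) := by nlinarith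
    calc (K : ℝ) * (σ ^ 2 * c) * Real.exp 1 = K * Real.exp 1 * (σ ^ 2 * c) := by ring
      _ ≤ (15 / 8) ^ 3 * ((K : ℝ) - 1) * (σ ^ 2 * c) := by gcongr
      _ = _ := by ring
  linarith

end CostBandit

/-! ### Assembly of the three bounds -/

theorem theorem4 (K : ℕ) (hK : 2 ≤ K) (σ B c : ℝ) (hσ : 0 < σ) (hB : 0 < B) (hc : 0 < c) :
    (∀ (H : ℝ≥0∞) (Δ₂ : ℝ), 0 < H → 0 ≤ Δ₂ →
      H / ENNReal.ofReal Δ₂ ≤ ENNReal.ofReal (σ ^ 2 * c)⁻¹ →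
      1 ≤ B →
      1 ≤ K * Real.log K * B * σ ^ (4 / 3 : ℝ) / c ^ (5 / 3 : ℝ) →
      (⨆ ν ∈ CostBandit.modelClassH hK σ B H Δ₂, CostBandit.dbcareRisk σ B c ν) ≤
        ENNReal.ofReal
          (550 * Real.log K * Real.log (K * Real.log K * B * σ ^ (4 / 3 : ℝ) / c ^ (5 / 3 : ℝ))
              * CostBandit.hardness σ c H Δ₂ + (K + 1) * c)) ∧
    (∀ (H : ℝ≥0∞) (Δ₂ : ℝ), 0 < H → 0 ≤ Δ₂ →
      ENNReal.ofReal (σ ^ 2 * c)⁻¹ < H / ENNReal.ofReal Δ₂ →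
      (⨆ ν ∈ CostBandit.modelClassH hK σ B H Δ₂, CostBandit.dbcareRisk σ B c ν) ≤
        ENNReal.ofReal
          (CostBandit.hardness σ c H Δ₂
            + 4 * Real.log K * (K * σ ^ 2 * c) ^ (1 / 3 : ℝ) + (K + 1) * c)) ∧
    (⨆ ν ∈ CostBandit.modelClass K σ B, CostBandit.dbcareRisk σ B c ν) ≤
      ENNReal.ofReal
        (20 * Real.log K * CostBandit.hardnessStar K σ c + (K + 1) * c) := by
  have hK2 : (2 : ℝ) ≤ K := by exact_mod_cast hK
  have hq : 0 ≤ Real.log K := Real.log_nonneg (by linarith)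
  refine ⟨fun H Δ₂ hH _ hHΔ hB1 hL => iSup₂_le fun ν hν => ?_,
    fun H Δ₂ _ hΔ hHΔ => iSup₂_le fun ν hν => ?_, iSup₂_le fun ν hν => ?_⟩
  · exact CostBandit.dbcareRisk_le_of_mem_modelClassH hK hσ hB1 hc hH hHΔ hL hν
  · refine (CostBandit.dbcareRisk_le hK hσ hB hc hν.1).trans (ENNReal.ofReal_le_ofReal ?_)
    rw [← CostBandit.cbrt_mul (by linarith) (by positivity), ← mul_assoc]
    -- In this regime h₂ = Δ₂/4 is needed only as a nonnegative summand.
    have h1 : 0 ≤ CostBandit.hardness σ c H Δ₂ := by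
      unfold CostBandit.hardness
      rw [if_neg (not_le.2 hHΔ)]
      linarith
    unfold CostBandit.cbrt
    linarith
  · refine (CostBandit.dbcareRisk_le hK hσ hB hc hν).trans (ENNReal.ofReal_le_ofReal ?_)
    have := mul_le_mul_of_nonneg_left (CostBandit.le_hardnessStar hK hσ hc) hq
    linarith
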